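/- **Definitions.** Let $\omega=e^{2\pi i/3}$. The *cell-centred Kreweras lattice* is the directed graph with vertex set $-\frac{2+\omega}{3}+\mathbb{Z}+\mathbb{Z}\omega\subset\mathbb{C}$ and with edges from each vertex $v$ to $v+1$, $v+\omega$ and $v+\omega^2$; thus the origin $0$ is the centre of a triangular cell whose boundary is a directed anticlockwise cycle, and the three corners of this cell are the vertices closest to $0$. A walk of length $n$ follows $n$ directed edges. Its *winding angle* is the total anticlockwise angle by which $x/|x|$ turns around $0$ as the point $x$ moves continuously along the walk. For $k\ge 0$ let \[T_k(u,q)=\sum_{n=0}^{\infty}(-1)^n(2n+1)^kq^{n(n+1)/2}\bigl(u^{n+1}-(-1)^ku^{-n}\bigr).\] **Theorem.** There is a unique power series $q\equiv q(t)\in\mathbb{Q}[[t]]$ with constant term $0$, having a cube root $q^{1/3}\in\mathbb{Q}[[t]]$, such that \[t=q^{1/3}\,\frac{T_1(1,q^3)}{4T_0(q,q^3)+6T_1(q,q^3)},\] and $q=t^3+15t^6+279t^9+O(t^{12})$. Let $w_0$ be one of the vertices of the cell-centred Kreweras lattice closest to the origin. Each walk from $w_0$ to a vertex closest to the origin has a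 well-defined winding angle, of the form $\frac{2\pi k}{3}$ with $k\in\mathbb{Z}$. Let $E(t,s)$ be the generating function of these walks, in which each walk of length $n$ and winding angle $\frac{2\pi k}{3}$ contributes $t^ns^k$. Then, in the field $\mathbb{Q}(s)((t))$ of formal Laurent series (where all the series below converge $t$-adically and all the denominators are nonzero), \[E(t,s)=\frac{s}{(1-s^3)t}\left(s-q^{-1/3}\frac{T_1(q^2,q^3)}{T_1(1,q^3)}-q^{-1/3}\frac{T_0(q,q^3)\,T_1(sq^{-2/3},q)}{T_1(1,q^3)\,T_0(sq^{-2/3},q)}\right).\] -/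

import Mathlib

namespace KrewerasWinding

noncomputable section

/-! ### The cell-centred Kreweras lattice, walks and winding angles -/

/-- The primitive cube root of unity `e^{2πi/3}`; the three steps of the lattice are the vectors
`1`, `ω`, `ω ^ 2` in the complex plane. -/
def ω : ℂ := Complex.exp (2 * Real.pi / 3 * Complex.I)

/-- The vertices of the cell-centred Kreweras lattice: the triangular lattice `ℤ + ℤ ω`, translated
so that the triangle with vertices `v`, `v + 1`, `v + 1 + ω` (for `v = -(2 + ω) / 3`), whose
boundary is a directed anticlockwise cycle, has its centre at the origin. -/
def vertices : Set ℂ := {z | ∃ a b : ℤ, z = -(2 + ω) / 3 + a + b * ω}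

/-- The directed edges of the lattice: from every vertex `v` to `v + 1`, `v + ω`, `v + ω ^ 2`. -/
def IsEdge (v w : ℂ) : Prop :=
  v ∈ vertices ∧ w ∈ vertices ∧ (w - v = 1 ∨ w - v = ω ∨ w - v = ω ^ 2)

/-- A vertex that is closest to the origin, among all vertices. -/
def IsClosest (v : ℂ) : Prop := v ∈ vertices ∧ ∀ u ∈ vertices, ‖v‖ ≤ ‖u‖

/-- `p` is the sequence of vertices of a walk of length `n`. -/
def IsWalk {n : ℕ} (p : Fin (n + 1) → ℂ) : Prop :=
  (∀ i, p i ∈ vertices) ∧ ∀ i : Fin n, IsEdge (p i.castSucc) (p i.succ)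

/-- The polygonal path with vertices `p 0, …, p n`, where at time `i + x`, `x ∈ [0, 1]`, the moving
point is at `(1 - x) p i + x p (i + 1)`, has winding angle `θ` around the origin: there is a
continuous determination `φ` of the argument of the moving point, whose total increase is `θ`. -/
def HasWindingAngle {n : ℕ} (p : Fin (n + 1) → ℂ) (θ : ℝ) : Prop :=
  ∃ φ : ℝ → ℝ, ContinuousOn φ (Set.Icc 0 (n : ℝ)) ∧
    (∀ i : Fin n, ∀ x ∈ Set.Icc (0 : ℝ) 1,
      (1 - x) * p i.castSucc + x * p i.succ =
        ‖(1 - x) * p i.castSucc + x * p i.succ‖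
          * Complex.exp (φ ((i : ℕ) + x) * Complex.I)) ∧
    φ n - φ 0 = θ

/-- `p` is a walk of length `n` from `w₀` to one of the vertices closest to the origin. -/
def IsExcursion (w₀ : ℂ) {n : ℕ} (p : Fin (n + 1) → ℂ) : Prop :=
  IsWalk p ∧ p 0 = w₀ ∧ IsClosest (p (Fin.last n))

/-- The number of walks of length `n` and winding angle `2πk/3` from `w₀` to a vertex closest to
the origin. -/
def excursionCount (w₀ : ℂ) (n : ℕ) (k : ℤ) : ℕ :=
  Nat.card {p : Fin (n + 1) → ℂ //
    IsExcursion w₀ p ∧ HasWindingAngle p (2 * Real.pi * k / 3)}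

/-! ### Generating functions and the series `T_k` -/

/-- The field `ℚ(s)((t))` of formal Laurent series in `t` over `ℚ(s)`, which carries its
`t`-adic topology. -/
abbrev L : Type := LaurentSeries (RatFunc ℚ)

/-- The variable `t`. -/
def t : L := HahnSeries.single 1 1

/-- The variable `s`. -/
def s : L := HahnSeries.C RatFunc.X

/-- The inclusion of `ℚ[[t]]` in `ℚ(s)((t))`. -/
def incl : PowerSeries ℚ →+* L :=
  (HahnSeries.ofPowerSeries ℤ (RatFunc ℚ)).comp (PowerSeries.map (algebraMap ℚ (RatFunc ℚ)))

/-- The generating function `E(t,s) = ∑_n t^n ∑_k (number of walks with n, k) s^k`. For each `n` there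
are finitely many walks, so the sum over `k` is finite. -/
def genE (w₀ : ℂ) : L :=
  HahnSeries.ofPowerSeries ℤ (RatFunc ℚ) (PowerSeries.mk fun n =>
    ∑ᶠ k : ℤ, (excursionCount w₀ n k : RatFunc ℚ) * RatFunc.X ^ k)

/-- The `n`-th term `(-1)^n (2n+1)^k q^{n(n+1)/2} (u^{n+1} - (-1)^k u^{-n})` of `T_k(u,q)`. -/
def termT (k : ℕ) (u q : L) (n : ℕ) : L :=
  (-1) ^ n * (2 * (n : L) + 1) ^ k * q ^ (n * (n + 1) / 2) *
    (u ^ (n + 1) - (-1) ^ k * u ^ (-(n : ℤ)))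

/-- The series `T_k(u,q) = ∑_{n ≥ 0} (-1)^n (2n+1)^k q^{n(n+1)/2} (u^{n+1} - (-1)^k u^{-n})`,
summed in the `t`-adic topology. -/
def T (k : ℕ) (u q : L) : L := ∑' n : ℕ, termT k u q n

/-- `q` is a power series in `t` without constant term, `r` is a cube root `q^{1/3}` of it, and
`t = q^{1/3} T_1(1,q^3) / (4 T_0(q,q^3) + 6 T_1(q,q^3))`. -/
def IsNome (q r : PowerSeries ℚ) : Prop :=
  PowerSeries.constantCoeff q = 0 ∧ r ^ 3 = q ∧
    t = incl r * (T 1 1 (incl q ^ 3) /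
      (4 * T 0 (incl q) (incl q ^ 3) + 6 * T 1 (incl q) (incl q ^ 3)))

end

end KrewerasWinding

/-! Three sectors of angle 2π/3, permuted by multiplication by `ω`, contain all the vertices. On the
universal cover of the punctured plane a vertex becomes `(k, i, j)`: the number of the sector and
coordinates inside it. Walks from a closest vertex are words in three letters, and an excursion with
winding angle 2πk/3 is a word ending at `(k, 0, 0)` (`excursionCount_eq`).

Let Q(x,y) count all words, and let A and B count those ending at i = 0 and at j = 0, so that E =
B(0). Considering the last step gives (xy − t(x²y² + x + y)) Q = xy + t(−y A(y) − x B(x) + s x y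
A(x) + s⁻¹ x y² B(y)), so the right side vanishes wherever the kernel does (`functional_equation`).

The kernel curve is parametrized by theta functions. Put r = q^{1/3}, and let α, β, γ be the theta
function of nome q³ = r⁹ at u, qu, q²u. Then x = rαγ/β² and y(u) = x(qu) = −r u⁻¹αβ/γ² lie on the
curve. This is the identity `theta_cubic`, and the equation between t and q is what fixes its
constant.

On the curve, and after multiplication by a theta product, the functional equation becomes a
q-difference equation W(qu) + s r u⁻¹ W(u) = −s r² t⁻¹ u⁻¹ α²γ. Correcting W by an explicit theta
polynomial leaves V with V(qu) = −s r u⁻¹ V(u). A solution of such an equation is determined by one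
coefficient (`eq_zero_of_qShift`), so V is proportional to u times `auxTheta`. Since x vanishes at u
= 1, V(1) and V'(1) involve only theta values and E, and comparing logarithmic derivatives at u = 1
yields E (`originSeries_theta`). The series T_0 and T_1 are, up to sign and a power of r, the
combinations f(1) and f(1) − 2f'(1) of these theta functions.

Everything is formal, in power series in t over Laurent polynomials in u. The substitution u ↦ qu is
no endomorphism of that ring, as it would need q⁻¹. Hence `QShift` is a relation between two series,
with negative powers of q moved to the other side. -/

/-! ### Formal q-difference calculus on power series over Laurent polynomials. -/

namespace WindingSeries

open PowerSeries

noncomputable section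

/-! ### Formal sums of power series -/

section FormalSum

variable {A B : Type*} [CommRing A] [CommRing B]

theorem eq_of_forall_X_pow_dvd_sub {f g : A⟦X⟧} (h : ∀ N : ℕ, X ^ N ∣ f - g) : f = g := by
  ext m
  have := X_pow_dvd_iff.1 (h (m + 1)) m (Nat.lt_succ_self m)
  rwa [map_sub, sub_eq_zero] at this

/-- The sum of a sequence of power series whose `n`-th term is divisible by `X ^ n`. -/
def formalSum (f : ℕ → A⟦X⟧) : A⟦X⟧ :=
  PowerSeries.mk fun m => ∑ n ∈ Finset.range (m + 1), coeff m (f n)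

theorem formalSum_sub_dvd {f : ℕ → A⟦X⟧} (hf : ∀ n, X ^ n ∣ f n) (N : ℕ) :
    X ^ N ∣ formalSum f - ∑ n ∈ Finset.range N, f n := by
  rw [X_pow_dvd_iff]
  intro m hm
  rw [map_sub, formalSum, coeff_mk, map_sum, sub_eq_zero]
  refine Finset.sum_subset (fun i hi => ?_) (fun i _ hi => ?_)
  · simp only [Finset.mem_range] at hi ⊢
    omega
  · simp only [Finset.mem_range] at hi
    exact X_pow_dvd_iff.1 (hf i) m (by omega)

theorem formalSum_eq {f : ℕ → A⟦X⟧} (hf : ∀ n, X ^ n ∣ f n) {g : A⟦X⟧}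
    (hg : ∀ N : ℕ, X ^ N ∣ g - ∑ n ∈ Finset.range N, f n) : formalSum f = g := by
  refine eq_of_forall_X_pow_dvd_sub fun N => ?_
  have := dvd_sub (formalSum_sub_dvd hf N) (hg N)
  rwa [sub_sub_sub_cancel_right] at this

theorem formalSum_sub (f g : ℕ → A⟦X⟧) :
    formalSum (fun n => f n - g n) = formalSum f - formalSum g := by
  ext m
  simp [formalSum, Finset.sum_sub_distrib]

theorem mul_formalSum {f : ℕ → A⟦X⟧} (hf : ∀ n, X ^ n ∣ f n) (c : A⟦X⟧) :
    formalSum (fun n => c * f n) = c * formalSum f := by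
  refine formalSum_eq (fun n => (hf n).mul_left c) fun N => ?_
  rw [← Finset.mul_sum, ← mul_sub]
  exact (formalSum_sub_dvd hf N).mul_left c

theorem formalSum_eq_zero : formalSum (fun _ => 0 : ℕ → A⟦X⟧) = 0 := by
  ext m
  simp [formalSum]

theorem formalSum_single {c : A⟦X⟧} {k : ℕ} (hc : X ^ k ∣ c) :
    formalSum (fun n => if n = k then c else 0) = c := by
  ext m
  simp only [formalSum, coeff_mk, apply_ite (coeff m), map_zero, Finset.sum_ite_eq',
    Finset.mem_range]
  split_ifs with h
  · rfl
  · exact (X_pow_dvd_iff.1 hc m (by omega)).symm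

theorem map_formalSum (φ : A →+* B) (f : ℕ → A⟦X⟧) :
    PowerSeries.map φ (formalSum f) = formalSum fun n => PowerSeries.map φ (f n) := by
  ext m
  simp [formalSum]

theorem X_pow_dvd_map (φ : A →+* B) {f : A⟦X⟧} {N : ℕ} (h : X ^ N ∣ f) :
    X ^ N ∣ PowerSeries.map φ f := by
  have := map_dvd (PowerSeries.map φ) h
  rwa [map_pow, map_X] at this

theorem constantCoeff_formalSum (f : ℕ → A⟦X⟧) :
    constantCoeff (formalSum f) = constantCoeff (f 0) := by
  rw [← coeff_zero_eq_constantCoeff_apply, formalSum, coeff_mk]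
  simp

end FormalSum

/-! ### Power series over Laurent polynomials -/

/-- Power series in `X` over the Laurent polynomials in a variable `u`. -/
abbrev LaurentPS (K : Type*) [Field K] := PowerSeries (LaurentPolynomial K)

variable {K : Type*} [Field K]

/-- The inclusion of the power series without `u`. -/
def emb : K⟦X⟧ →+* LaurentPS K := PowerSeries.map LaurentPolynomial.C

/-- The monomial `u ^ n`. -/
def mono (n : ℤ) : LaurentPS K := PowerSeries.C (LaurentPolynomial.T n)

theorem mono_mul_mono (m n : ℤ) : (mono m : LaurentPS K) * mono n = mono (m + n) := by
  rw [mono, mono, mono, ← map_mul, LaurentPolynomial.T_add]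

theorem mono_zero : (mono 0 : LaurentPS K) = 1 := by
  rw [mono, LaurentPolynomial.T_zero, map_one]

/-- The coefficient of `u ^ n`. -/
def ucoeff (n : ℤ) : LaurentPS K →+ K⟦X⟧ where
  toFun f := PowerSeries.mk fun m => (coeff m f).coeff n
  map_zero' := by ext m; simp
  map_add' f g := by ext m; simp

theorem coeff_ucoeff (n : ℤ) (m : ℕ) (f : LaurentPS K) :
    coeff m (ucoeff n f) = (coeff m f).coeff n :=
  coeff_mk m fun m => (coeff m f).coeff n

theorem ext_ucoeff {f g : LaurentPS K} (h : ∀ n, ucoeff n f = ucoeff n g) : f = g := by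
  ext m n
  rw [← coeff_ucoeff, h, coeff_ucoeff]

theorem ucoeff_emb_mul (n : ℤ) (c : K⟦X⟧) (f : LaurentPS K) :
    ucoeff n (emb c * f) = c * ucoeff n f := by
  ext m
  rw [coeff_ucoeff, coeff_mul, coeff_mul, AddMonoidAlgebra.coeff_sum, Finset.sum_apply']
  refine Finset.sum_congr rfl fun p _ => ?_
  rw [emb, coeff_map, ← LaurentPolynomial.smul_eq_C_mul, AddMonoidAlgebra.coeff_smul_apply,
    coeff_ucoeff, smul_eq_mul]

theorem ucoeff_mono_mul (n k : ℤ) (f : LaurentPS K) :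
    ucoeff n (mono k * f) = ucoeff (n - k) f := by
  ext m
  rw [coeff_ucoeff, mono, coeff_C_mul, coeff_ucoeff, LaurentPolynomial.T,
    AddMonoidAlgebra.coeff_single_mul_eq_mul_coeff (m₂ := n - k), one_mul]
  intro a _
  omega

theorem ucoeff_mono (n k : ℤ) : ucoeff n (mono k : LaurentPS K) = if n = k then 1 else 0 := by
  ext m
  rw [coeff_ucoeff, mono, coeff_C]
  by_cases hm : m = 0 <;> by_cases hn : n = k <;> simp [hm, hn, coeff_one, eq_comm (a := k)]

theorem ucoeff_emb_mul_mono (n k : ℤ) (c : K⟦X⟧) :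
    ucoeff n (emb c * mono k) = if n = k then c else 0 := by
  rw [ucoeff_emb_mul, ucoeff_mono]
  split_ifs <;> simp

theorem X_pow_dvd_ucoeff {N : ℕ} {f : LaurentPS K} (h : X ^ N ∣ f) (n : ℤ) :
    X ^ N ∣ ucoeff n f := by
  rw [X_pow_dvd_iff] at h ⊢
  intro m hm
  rw [coeff_ucoeff, h m hm]
  rfl

theorem X_pow_dvd_emb {N : ℕ} {c : K⟦X⟧} (h : X ^ N ∣ c) : X ^ N ∣ emb c := X_pow_dvd_map _ h

theorem ucoeff_formalSum (n : ℤ) (f : ℕ → LaurentPS K) :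
    ucoeff n (formalSum f) = formalSum fun m => ucoeff n (f m) := by
  ext m
  simp only [coeff_ucoeff, formalSum, coeff_mk]
  rw [AddMonoidAlgebra.coeff_sum, Finset.sum_apply']

/-- Each of the first `N` coefficients is a Laurent polynomial, so modulo `X ^ N` only finitely many
powers of u occur. -/
theorem exists_finset_approx (f : LaurentPS K) (N : ℕ) :
    ∃ M : Finset ℤ, X ^ N ∣ f - ∑ i ∈ M, emb (ucoeff i f) * mono i := by
  refine ⟨(Finset.range N).biUnion fun m => (coeff m f).coeff.support, ?_⟩
  rw [X_pow_dvd_iff]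
  intro m hm
  rw [map_sub, sub_eq_zero, map_sum]
  have hterm : ∀ i, coeff m (emb (ucoeff i f) * mono i)
      = AddMonoidAlgebra.single i ((coeff m f).coeff i) := by
    intro i
    rw [mono, coeff_mul_C, emb, coeff_map, coeff_ucoeff, LaurentPolynomial.single_eq_C_mul_T]
  simp only [hterm]
  conv_lhs => rw [← AddMonoidAlgebra.sum_coeff_single (coeff m f)]
  refine Finset.sum_subset (fun i hi => ?_) (fun i _ hi => ?_)
  · exact Finset.mem_biUnion.2 ⟨m, Finset.mem_range.2 hm, hi⟩
  · rw [Finsupp.notMem_support_iff.1 hi, AddMonoidAlgebra.single_zero]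

/-! ### The substitution `u ↦ q u` -/

/-- The relation `g(u) = f(q u)`. -/
def QShift (q : K⟦X⟧) (f g : LaurentPS K) : Prop :=
  ∀ n : ℤ, q ^ (-n).toNat * ucoeff n g = q ^ n.toNat * ucoeff n f

namespace QShift

variable {q : K⟦X⟧} {f f' g g' : LaurentPS K}

theorem of_approx (h : ∀ N : ℕ, ∃ f₁ g₁, QShift q f₁ g₁ ∧ X ^ N ∣ f - f₁ ∧ X ^ N ∣ g - g₁) :
    QShift q f g := by
  intro n
  refine eq_of_forall_X_pow_dvd_sub fun N => ?_
  obtain ⟨f₁, g₁, h₁, hf, hg⟩ := h N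
  have hf' := (X_pow_dvd_ucoeff hf n).mul_left (q ^ n.toNat)
  have hg' := (X_pow_dvd_ucoeff hg n).mul_left (q ^ (-n).toNat)
  rw [map_sub, mul_sub] at hf' hg'
  have := dvd_sub hg' hf'
  rwa [← h₁ n, sub_sub_sub_cancel_right] at this

theorem add (h : QShift q f g) (h' : QShift q f' g') : QShift q (f + f') (g + g') := by
  intro n
  rw [map_add, map_add, mul_add, mul_add, h, h']

theorem neg (h : QShift q f g) : QShift q (-f) (-g) := by
  intro n
  rw [map_neg, map_neg, mul_neg, mul_neg, h]

theorem sub (h : QShift q f g) (h' : QShift q f' g') : QShift q (f - f') (g - g') := by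
  rw [sub_eq_add_neg, sub_eq_add_neg]
  exact h.add h'.neg

theorem emb_mul (c : K⟦X⟧) (h : QShift q f g) : QShift q (emb c * f) (emb c * g) := by
  intro n
  rw [ucoeff_emb_mul, ucoeff_emb_mul, mul_left_comm, h, mul_left_comm]

theorem zero : QShift q (0 : LaurentPS K) 0 := by
  intro n
  simp

theorem one : QShift q (1 : LaurentPS K) 1 := by
  intro n
  rw [← mono_zero, ucoeff_mono]
  split_ifs with h
  · simp [h]
  · simp

theorem emb (c : K⟦X⟧) : QShift q (WindingSeries.emb c) (WindingSeries.emb c) := by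
  simpa using one.emb_mul c

theorem mono_one : QShift q (mono 1 : LaurentPS K) (WindingSeries.emb q * mono 1) := by
  intro n
  rw [ucoeff_emb_mul, ucoeff_mono]
  split_ifs with h
  · simp [h]
  · simp

theorem sum {ι : Type*} {a : Finset ι} {F G : ι → LaurentPS K}
    (h : ∀ i ∈ a, QShift q (F i) (G i)) : QShift q (∑ i ∈ a, F i) (∑ i ∈ a, G i) := by
  intro n
  rw [map_sum, map_sum, Finset.mul_sum, Finset.mul_sum]
  exact Finset.sum_congr rfl fun i hi => h i hi n

/-- A coefficient of a product is an infinite convolution in u. Modulo `X ^ N` it is a finite one,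
and there the claim holds term by term because q^i q^(n-i) = q^n. -/
theorem mul (hq : q ≠ 0) (h : QShift q f g) (h' : QShift q f' g') :
    QShift q (f * f') (g * g') := by
  intro n
  refine eq_of_forall_X_pow_dvd_sub fun N => ?_
  have key : ∀ (f f' : LaurentPS K) (M : Finset ℤ),
      X ^ N ∣ f - ∑ i ∈ M, WindingSeries.emb (ucoeff i f) * mono i →
      X ^ N ∣ ucoeff n (f * f') - ∑ i ∈ M, ucoeff i f * ucoeff (n - i) f' := by
    intro f f' M hM
    have := X_pow_dvd_ucoeff (hM.mul_right f') n
    rw [sub_mul, map_sub, Finset.sum_mul, map_sum] at this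
    simpa only [mul_assoc, ucoeff_emb_mul, ucoeff_mono_mul] using this
  -- Enlarging the set of exponents does no harm, so one union serves both `f` and `g`.
  have mono_approx : ∀ (f : LaurentPS K), ∃ M : Finset ℤ, ∀ M', M ⊆ M' →
      X ^ N ∣ f - ∑ i ∈ M', WindingSeries.emb (ucoeff i f) * mono i := by
    intro f
    obtain ⟨M, hM⟩ := exists_finset_approx f N
    refine ⟨M, fun M' hMM' => ?_⟩
    have hrest : ∀ i ∉ M, X ^ N ∣ ucoeff i f := by
      intro i hi
      have := X_pow_dvd_ucoeff hM i
      rw [map_sub, map_sum, Finset.sum_eq_zero, sub_zero] at this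
      · exact this
      · intro j hj
        rw [ucoeff_emb_mul_mono, if_neg]
        rintro rfl
        exact hi hj
    rw [← Finset.sum_sdiff hMM', add_comm, ← sub_sub]
    refine dvd_sub hM (Finset.dvd_sum fun i hi => ?_)
    exact (X_pow_dvd_emb (hrest i (Finset.mem_sdiff.1 hi).2)).mul_right _
  obtain ⟨M₁, hM₁⟩ := mono_approx f
  obtain ⟨M₂, hM₂⟩ := mono_approx g
  have hf := (key f f' (M₁ ∪ M₂) (hM₁ _ Finset.subset_union_left)).mul_left (q ^ n.toNat)
  have hg := (key g g' (M₁ ∪ M₂) (hM₂ _ Finset.subset_union_right)).mul_left (q ^ (-n).toNat)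
  rw [mul_sub] at hf hg
  have hsum : q ^ (-n).toNat * ∑ i ∈ M₁ ∪ M₂, ucoeff i g * ucoeff (n - i) g'
      = q ^ n.toNat * ∑ i ∈ M₁ ∪ M₂, ucoeff i f * ucoeff (n - i) f' := by
    rw [Finset.mul_sum, Finset.mul_sum]
    refine Finset.sum_congr rfl fun i _ => ?_
    have h1 := h i
    have h2 := h' (n - i)
    -- This factor supplies the powers of q that the hypotheses at `i` and `n - i` require when
    -- these indices are negative.
    refine mul_left_cancel₀ (pow_ne_zero ((-i).toNat + (-(n - i)).toNat) hq) ?_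
    have e : (-i).toNat + (-(n - i)).toNat + n.toNat
        = i.toNat + (n - i).toNat + (-n).toNat := by omega
    calc q ^ ((-i).toNat + (-(n - i)).toNat) * (q ^ (-n).toNat * (ucoeff i g * ucoeff (n - i) g'))
        = q ^ (-n).toNat * ((q ^ (-i).toNat * ucoeff i g) *
          (q ^ (-(n - i)).toNat * ucoeff (n - i) g')) := by ring
      _ = q ^ (i.toNat + (n - i).toNat + (-n).toNat) * (ucoeff i f * ucoeff (n - i) f') := by
        rw [h1, h2]; ring
      _ = _ := by rw [← e]; ring
  have := dvd_sub hg hf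
  rwa [hsum, sub_sub_sub_cancel_right] at this

theorem pow (hq : q ≠ 0) (h : QShift q f g) (n : ℕ) : QShift q (f ^ n) (g ^ n) := by
  induction n with
  | zero => simpa using one
  | succ n ih => simpa only [pow_succ] using ih.mul hq h

theorem formalSum {F G : ℕ → LaurentPS K} (hF : ∀ n, X ^ n ∣ F n) (hG : ∀ n, X ^ n ∣ G n)
    (h : ∀ n, QShift q (F n) (G n)) :
    QShift q (WindingSeries.formalSum F) (WindingSeries.formalSum G) :=
  of_approx fun N => ⟨_, _, sum fun i _ => h i, formalSum_sub_dvd hF N, formalSum_sub_dvd hG N⟩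

/-- Both inverses are limits of geometric sums, to which the sum and power rules apply. -/
theorem inv (hq : q ≠ 0) (h : QShift q f g) (hf : f * f' = 1) (hg : g * g' = 1)
    (hf1 : X ∣ 1 - f) (hg1 : X ∣ 1 - g) : QShift q f' g' := by
  refine of_approx fun N => ⟨∑ k ∈ Finset.range N, (1 - f) ^ k, ∑ k ∈ Finset.range N, (1 - g) ^ k,
    sum fun k _ => (one.sub h).pow hq k, ?_, ?_⟩
  · have e := mul_neg_geom_sum (1 - f) N
    have : f' - ∑ k ∈ Finset.range N, (1 - f) ^ k = f' * (1 - f) ^ N := by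
      linear_combination (-f') * e + (∑ k ∈ Finset.range N, (1 - f) ^ k) * hf
    rw [this]
    exact (pow_dvd_pow_of_dvd hf1 N).mul_left _
  · have e := mul_neg_geom_sum (1 - g) N
    have : g' - ∑ k ∈ Finset.range N, (1 - g) ^ k = g' * (1 - g) ^ N := by
      linear_combination (-g') * e + (∑ k ∈ Finset.range N, (1 - g) ^ k) * hg
    rw [this]
    exact (pow_dvd_pow_of_dvd hg1 N).mul_left _

end QShift

/-- A solution of `f(q u) = c u⁻¹ f(u)` is determined by its coefficient of `u ^ 0`. -/
theorem eq_zero_of_qShift {q c : K⟦X⟧} (hc : c ≠ 0) {f : LaurentPS K}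
    (h : QShift q f (emb c * (mono (-1) * f))) (h0 : ucoeff 0 f = 0) : f = 0 := by
  -- A two-term recurrence: upwards from 0 one cancels `c`, downwards the new coefficient stands
  -- alone.
  have hrec : ∀ n : ℤ, q ^ (-n).toNat * (c * ucoeff (n + 1) f) = q ^ n.toNat * ucoeff n f := by
    intro n
    have := h n
    rwa [ucoeff_emb_mul, ucoeff_mono_mul, sub_neg_eq_add] at this
  refine ext_ucoeff fun n => ?_
  rw [map_zero]
  induction n using Int.induction_on with
  | zero => exact h0
  | succ k ih =>
    have := hrec k
    rw [ih, mul_zero, Int.toNat_eq_zero.2 (by omega : -(k : ℤ) ≤ 0), pow_zero, one_mul] at this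
    exact (mul_eq_zero.1 this).resolve_left hc
  | pred k ih =>
    have := hrec (-(k : ℤ) - 1)
    rw [sub_add_cancel, ih, mul_zero, mul_zero,
      Int.toNat_eq_zero.2 (by omega : -(k : ℤ) - 1 ≤ 0), pow_zero, one_mul] at this
    exact this.symm

/-! ### Value and derivative at `u = 1` -/

/-- Evaluation at `u = 1`. -/
def evalOne : LaurentPS K →+* K⟦X⟧ :=
  PowerSeries.map (LaurentPolynomial.eval₂ (RingHom.id K) 1)

theorem evalOne_emb (c : K⟦X⟧) : evalOne (emb c) = c := by
  ext m
  rw [evalOne, emb, coeff_map, coeff_map, LaurentPolynomial.eval₂_C, RingHom.id_apply]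

theorem evalOne_mono (n : ℤ) : evalOne (mono n : LaurentPS K) = 1 := by
  rw [evalOne, mono, map_C, LaurentPolynomial.eval₂_T]
  simp

/-- The derivative at `u = 1` of a Laurent polynomial. -/
def polyDerivOne : LaurentPolynomial K →+ K where
  toFun f := f.coeff.sum fun n c => n * c
  map_zero' := by simp
  map_add' f g := by
    rw [AddMonoidAlgebra.coeff_add]
    exact Finsupp.sum_add_index' (by simp) (by intros; ring)

theorem polyDerivOne_C_mul_T (a : K) (n : ℤ) :
    polyDerivOne (LaurentPolynomial.C a * LaurentPolynomial.T n) = n * a := by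
  rw [← LaurentPolynomial.single_eq_C_mul_T]
  change (Finsupp.single n a).sum _ = _
  simp

theorem polyDerivOne_mul (f g : LaurentPolynomial K) :
    polyDerivOne (f * g) = polyDerivOne f * LaurentPolynomial.eval₂ (RingHom.id K) 1 g
      + LaurentPolynomial.eval₂ (RingHom.id K) 1 f * polyDerivOne g := by
  induction f using LaurentPolynomial.induction_on' with
  | add p r hp hr => rw [add_mul, map_add, hp, hr, map_add, map_add]; ring
  | C_mul_T n a =>
    induction g using LaurentPolynomial.induction_on' with
    | add p r hp hr => rw [mul_add, map_add, hp, hr, map_add, map_add]; ring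
    | C_mul_T m b =>
      have : LaurentPolynomial.C a * LaurentPolynomial.T n *
          (LaurentPolynomial.C b * LaurentPolynomial.T m)
          = LaurentPolynomial.C (a * b) * LaurentPolynomial.T (n + m) := by
        rw [map_mul, LaurentPolynomial.T_add]; ring
      rw [this, polyDerivOne_C_mul_T, polyDerivOne_C_mul_T, polyDerivOne_C_mul_T,
        LaurentPolynomial.eval₂_C_mul_T, LaurentPolynomial.eval₂_C_mul_T]
      simp
      ring

/-- The derivative at `u = 1`. -/
def derivOne : LaurentPS K →+ K⟦X⟧ where
  toFun f := PowerSeries.mk fun m => polyDerivOne (coeff m f)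
  map_zero' := by ext m; simp
  map_add' f g := by ext m; simp

theorem coeff_derivOne (m : ℕ) (f : LaurentPS K) :
    coeff m (derivOne f) = polyDerivOne (coeff m f) :=
  coeff_mk m fun m => polyDerivOne (coeff m f)

theorem derivOne_mul (f g : LaurentPS K) :
    derivOne (f * g) = derivOne f * evalOne g + evalOne f * derivOne g := by
  ext m
  rw [coeff_derivOne, map_add, coeff_mul, coeff_mul, coeff_mul, map_sum, ← Finset.sum_add_distrib]
  refine Finset.sum_congr rfl fun p _ => ?_
  rw [polyDerivOne_mul, coeff_derivOne, coeff_derivOne, evalOne, coeff_map, coeff_map]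

theorem derivOne_emb (c : K⟦X⟧) : derivOne (emb c) = 0 := by
  ext m
  have := polyDerivOne_C_mul_T (coeff m c) 0
  rw [LaurentPolynomial.T_zero, mul_one] at this
  rw [coeff_derivOne, emb, coeff_map, this]
  simp

theorem derivOne_emb_mul (c : K⟦X⟧) (f : LaurentPS K) :
    derivOne (emb c * f) = c * derivOne f := by
  rw [derivOne_mul, derivOne_emb, evalOne_emb, zero_mul, zero_add]

theorem derivOne_mono (n : ℤ) : derivOne (mono n : LaurentPS K) = (n : K⟦X⟧) := by
  ext m
  rw [coeff_derivOne, mono, coeff_C]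
  have h1 := polyDerivOne_C_mul_T (1 : K) n
  rw [map_one, one_mul, mul_one] at h1
  have h2 : (n : K⟦X⟧) = PowerSeries.C (n : K) := by simp
  rw [h2, coeff_C]
  split_ifs with h
  · exact h1
  · simp

theorem derivOne_formalSum (f : ℕ → LaurentPS K) :
    derivOne (formalSum f) = formalSum fun m => derivOne (f m) := by
  ext m
  simp only [coeff_derivOne, formalSum, coeff_mk, map_sum]

theorem derivOne_pow (f : LaurentPS K) (n : ℕ) :
    derivOne (f ^ (n + 1)) = (n + 1 : ℕ) * evalOne f ^ n * derivOne f := by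
  induction n with
  | zero => simp
  | succ n ih =>
    rw [pow_succ, derivOne_mul, ih, map_pow]
    push_cast
    ring

/-! ### Bilateral series -/

/-- The bilateral series `∑ n, c n * u ^ n`. -/
def bilateral (c : ℤ → K⟦X⟧) : LaurentPS K :=
  formalSum fun m => emb (c (-m)) * mono (-m) + emb (c (m + 1)) * mono (m + 1)

/-- The coefficients of a bilateral series tend to zero sufficiently fast. -/
def Decays (c : ℤ → K⟦X⟧) : Prop := ∀ m : ℕ, X ^ m ∣ c (-m) ∧ X ^ m ∣ c (m + 1)

/-- Every integer is exactly one of `-m` and `m + 1` with `m ≥ 0`, so a single summand contributes;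
the decay ensures that the truncated sum sees it. -/
theorem ucoeff_bilateral {c : ℤ → K⟦X⟧} (hc : Decays c) (n : ℤ) :
    ucoeff n (bilateral c) = c n := by
  rw [bilateral, ucoeff_formalSum]
  simp only [map_add, ucoeff_emb_mul_mono]
  rcases le_or_gt n 0 with hn | hn
  · obtain ⟨k, rfl⟩ := Int.eq_ofNat_of_zero_le (neg_nonneg.2 hn) |>.imp fun k hk =>
      (neg_eq_iff_eq_neg.1 hk)
    rw [← formalSum_single (hc k).1]
    congr 1
    ext1 m
    by_cases h : m = k
    · subst h
      rw [if_pos rfl, if_neg (by omega), if_pos rfl, add_zero]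
    · rw [if_neg (by omega), if_neg (by omega), if_neg h, add_zero]
  · obtain ⟨k, rfl⟩ : ∃ k : ℕ, n = k + 1 := ⟨(n - 1).toNat, by omega⟩
    rw [← formalSum_single (hc k).2]
    congr 1
    ext1 m
    by_cases h : m = k
    · subst h
      rw [if_neg (by omega), if_pos rfl, if_pos rfl, zero_add]
    · rw [if_neg (by omega), if_neg (by omega), if_neg h, add_zero]

theorem evalOne_bilateral (c : ℤ → K⟦X⟧) :
    evalOne (bilateral c) = formalSum fun m : ℕ => c (-m) + c (m + 1) := by
  rw [bilateral, evalOne, map_formalSum]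
  congr 1
  ext1 m
  change evalOne _ = _
  simp only [map_add, map_mul, evalOne_emb, evalOne_mono, mul_one]

theorem derivOne_bilateral (c : ℤ → K⟦X⟧) :
    derivOne (bilateral c)
      = formalSum fun m : ℕ => -(m : K⟦X⟧) * c (-m) + ((m : K⟦X⟧) + 1) * c (m + 1) := by
  rw [bilateral, derivOne_formalSum]
  congr 1
  ext1 m
  rw [map_add, derivOne_emb_mul, derivOne_emb_mul, derivOne_mono, derivOne_mono]
  push_cast
  ring

theorem qShift_bilateral {q : K⟦X⟧} {c d : ℤ → K⟦X⟧} (hc : Decays c) (hd : Decays d)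
    (h : ∀ n : ℤ, q ^ (-n).toNat * d n = q ^ n.toNat * c n) :
    QShift q (bilateral c) (bilateral d) := by
  intro n
  rw [ucoeff_bilateral hc, ucoeff_bilateral hd, h]

end

end WindingSeries

/-! ### Theta functions of nome r⁹ and their cubic relation. -/

namespace WindingSeries

open PowerSeries

noncomputable section

variable {K : Type*} [Field K]

/-! ### Reflection `u ↦ u⁻¹` -/

theorem eval₂_invert (f : LaurentPolynomial K) :
    LaurentPolynomial.eval₂ (RingHom.id K) 1 (LaurentPolynomial.invert f)
      = LaurentPolynomial.eval₂ (RingHom.id K) 1 f := by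
  induction f using LaurentPolynomial.induction_on' with
  | add p r hp hr => rw [map_add, map_add, hp, hr, map_add]
  | C_mul_T n a => simp [LaurentPolynomial.eval₂_C_mul_T]

theorem polyDerivOne_invert (f : LaurentPolynomial K) :
    polyDerivOne (LaurentPolynomial.invert f) = -polyDerivOne f := by
  induction f using LaurentPolynomial.induction_on' with
  | add p r hp hr => rw [map_add, map_add, hp, hr, map_add, neg_add]
  | C_mul_T n a =>
    rw [map_mul, LaurentPolynomial.invert_T, LaurentPolynomial.invert_C, polyDerivOne_C_mul_T,
      polyDerivOne_C_mul_T]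
    push_cast
    ring

theorem coeff_eq_invert {f g : LaurentPS K} (h : ∀ n, ucoeff n f = ucoeff (-n) g) (m : ℕ) :
    coeff m f = LaurentPolynomial.invert (coeff m g) := by
  ext n
  rw [← coeff_ucoeff, h, coeff_ucoeff, LaurentPolynomial.invert_apply]

theorem evalOne_reflect {f g : LaurentPS K} (h : ∀ n, ucoeff n f = ucoeff (-n) g) :
    evalOne f = evalOne g := by
  ext m
  rw [evalOne, coeff_map, coeff_map, coeff_eq_invert h, eval₂_invert]

theorem derivOne_reflect {f g : LaurentPS K} (h : ∀ n, ucoeff n f = ucoeff (-n) g) :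
    derivOne f = -derivOne g := by
  ext m
  rw [map_neg, coeff_derivOne, coeff_derivOne, coeff_eq_invert h, polyDerivOne_invert]

/-! ### Exponents -/

/-- The number `n (n - 1) / 2`. -/
def tri (n : ℤ) : ℤ := n * (n - 1) / 2

theorem two_mul_tri (n : ℤ) : 2 * tri n = n * (n - 1) :=
  Int.mul_ediv_cancel' (Int.even_mul_pred_self n).two_dvd

theorem tri_succ (n : ℤ) : tri (n + 1) = tri n + n := by
  have h1 := two_mul_tri n
  have h2 := two_mul_tri (n + 1)
  linarith

theorem tri_neg (n : ℤ) : tri (-n) = tri n + n := by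
  have h1 := two_mul_tri n
  have h2 := two_mul_tri (-n)
  linarith

theorem tri_zero : tri 0 = 0 := rfl

theorem tri_one : tri 1 = 0 := rfl

/-- These linear bounds reduce the decay of the theta coefficients to linear arithmetic. -/
theorem natCast_le_tri_add (m : ℕ) : (m : ℤ) ≤ tri m + m ∧ 2 * (m : ℤ) ≤ 3 * tri m + 2 := by
  have h1 := two_mul_tri m
  have h0 : 0 ≤ tri m := by
    rcases m with _ | m
    · simp [tri_zero]
    · push_cast at *; nlinarith
  refine ⟨by linarith, ?_⟩
  rcases m with _ | _ | m
  · simp [tri_zero]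
  · simp [tri_one]
  · push_cast at *; nlinarith

theorem tri_nonneg (n : ℤ) : 0 ≤ tri n := by
  have h1 := two_mul_tri n
  rcases le_or_gt n 0 with h | h <;> nlinarith

/-- The sign `(-1) ^ n`. -/
def sgn (n : ℤ) : K⟦X⟧ := (-1) ^ n.natAbs

theorem sgn_neg (n : ℤ) : (sgn (-n) : K⟦X⟧) = sgn n := by
  rw [sgn, sgn, Int.natAbs_neg]

theorem sgn_succ (n : ℤ) : (sgn (n + 1) : K⟦X⟧) = -sgn n := by
  rcases le_or_gt 0 n with h | h
  · rw [sgn, sgn, show (n + 1).natAbs = n.natAbs + 1 by omega, pow_succ]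
    ring
  · rw [sgn, sgn, show n.natAbs = (n + 1).natAbs + 1 by omega, pow_succ]
    ring

theorem sgn_natCast (m : ℕ) : (sgn m : K⟦X⟧) = (-1) ^ m := rfl

theorem sgn_zero : (sgn 0 : K⟦X⟧) = 1 := by simp [sgn]

theorem sgn_one : (sgn 1 : K⟦X⟧) = -1 := by simp [sgn]

/-! ### Cubic theta functions -/

/-- The coefficients of the theta function with nome `r ^ 9`, with `u` replaced by
`r ^ (3 * j) * u`. -/
def thetaCoeff (r : K⟦X⟧) (j : ℕ) (n : ℤ) : K⟦X⟧ := sgn n * r ^ (9 * tri n + 3 * j * n).toNat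

/-- The theta function with nome `r ^ 9`, evaluated at `r ^ (3 * j) * u`. -/
def theta (r : K⟦X⟧) (j : ℕ) : LaurentPS K := bilateral (thetaCoeff r j)

theorem X_pow_dvd_pow {r : K⟦X⟧} (hr : X ∣ r) {m k : ℕ} (h : m ≤ k) : X ^ m ∣ r ^ k :=
  (pow_dvd_pow X h).trans (pow_dvd_pow_of_dvd hr k)

/-- Ensures that `toNat` truncates nothing in `thetaCoeff`. -/
theorem thetaCoeff_exp_nonneg {j : ℕ} (hj : j ≤ 2) (n : ℤ) : 0 ≤ 9 * tri n + 3 * j * n := by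
  have h1 := two_mul_tri n
  have h2 := tri_nonneg n
  have : (j : ℤ) = 0 ∨ (j : ℤ) = 1 ∨ (j : ℤ) = 2 := by omega
  rcases le_or_gt 0 n with h | h
  · positivity
  · rcases this with h' | h' | h' <;> rw [h'] <;> nlinarith

theorem decays_thetaCoeff {r : K⟦X⟧} (hr : X ∣ r) {j : ℕ} (hj : j ≤ 2) :
    Decays (thetaCoeff r j) := by
  intro m
  obtain ⟨h1, h2⟩ := natCast_le_tri_add m
  have hj' : (j : ℤ) = 0 ∨ (j : ℤ) = 1 ∨ (j : ℤ) = 2 := by omega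
  refine ⟨(X_pow_dvd_pow hr ?_).mul_left _, (X_pow_dvd_pow hr ?_).mul_left _⟩
  · rw [tri_neg]
    rcases hj' with h' | h' | h' <;> rw [h'] <;> omega
  · rw [tri_succ]
    rcases hj' with h' | h' | h' <;> rw [h'] <;> omega

theorem thetaCoeff_zero (r : K⟦X⟧) (j : ℕ) : thetaCoeff r j 0 = 1 := by
  simp [thetaCoeff, sgn_zero, tri_zero]

theorem thetaCoeff_one (r : K⟦X⟧) (j : ℕ) : thetaCoeff r j 1 = -r ^ (3 * j) := by
  rw [thetaCoeff, sgn_one, tri_one, show (9 * 0 + 3 * (j : ℤ) * 1).toNat = 3 * j by omega]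
  ring

theorem qShift_theta {r : K⟦X⟧} (hr : X ∣ r) {j : ℕ} (hj : j ≤ 1) :
    QShift (r ^ 3) (theta r j) (theta r (j + 1)) := by
  refine qShift_bilateral (decays_thetaCoeff hr (by omega)) (decays_thetaCoeff hr (by omega))
    fun n => ?_
  have h1 := thetaCoeff_exp_nonneg (show j ≤ 2 by omega) n
  have h2 := thetaCoeff_exp_nonneg (show j + 1 ≤ 2 by omega) n
  have e : 9 * tri n + 3 * ((j + 1 : ℕ) : ℤ) * n = 9 * tri n + 3 * j * n + 3 * n := by
    push_cast; ring
  rw [thetaCoeff, thetaCoeff, mul_left_comm, mul_left_comm (_ ^ n.toNat), ← pow_mul, ← pow_mul,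
    ← pow_add, ← pow_add]
  rw [e] at h2 ⊢
  generalize 9 * tri n + 3 * (j : ℤ) * n = a at *
  congr 2
  omega

/-- Three shifts by r³ amount to one shift by the nome r⁹, and reindexing n ↦ n + 1 gives the
quasi-periodicity θ(r⁹u) = −u⁻¹θ(u). -/
theorem qShift_theta_two {r : K⟦X⟧} (hr : X ∣ r) :
    QShift (r ^ 3) (theta r 2) (-(mono (-1) * theta r 0)) := by
  intro n
  have h1 := thetaCoeff_exp_nonneg le_rfl n
  have h2 := tri_nonneg n
  rw [map_neg, ucoeff_mono_mul, sub_neg_eq_add, theta, theta,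
    ucoeff_bilateral (decays_thetaCoeff hr le_rfl),
    ucoeff_bilateral (decays_thetaCoeff hr (Nat.zero_le _)), thetaCoeff, thetaCoeff, sgn_succ,
    neg_mul, neg_neg, mul_left_comm, mul_left_comm (_ ^ n.toNat), ← pow_mul, ← pow_mul,
    ← pow_add, ← pow_add]
  congr 2
  have h3 := tri_nonneg (n + 1)
  rw [tri_succ] at h3 ⊢
  push_cast at *
  omega

/-- This says γ(u) = β(u⁻¹). Hence at u = 1 the values agree and the derivatives are opposite. -/
theorem ucoeff_theta_reflect {r : K⟦X⟧} (hr : X ∣ r) (n : ℤ) :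
    ucoeff n (theta r 2) = ucoeff (-n) (theta r 1) := by
  rw [theta, theta, ucoeff_bilateral (decays_thetaCoeff hr le_rfl),
    ucoeff_bilateral (decays_thetaCoeff hr (by omega)), thetaCoeff, thetaCoeff, sgn_neg, tri_neg]
  congr 3
  push_cast
  ring

theorem evalOne_theta_two {r : K⟦X⟧} (hr : X ∣ r) :
    evalOne (theta r 2) = evalOne (theta r 1) := evalOne_reflect (ucoeff_theta_reflect hr)

theorem derivOne_theta_two {r : K⟦X⟧} (hr : X ∣ r) :
    derivOne (theta r 2) = -derivOne (theta r 1) := derivOne_reflect (ucoeff_theta_reflect hr)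

/-- The terms of index `-m` and `m + 1` have the same exponent and opposite signs. -/
theorem evalOne_theta_zero (r : K⟦X⟧) : evalOne (theta r 0) = 0 := by
  rw [theta, evalOne_bilateral, ← formalSum_eq_zero]
  congr 1
  ext1 m
  rw [thetaCoeff, thetaCoeff, sgn_neg, sgn_succ, tri_neg, tri_succ]
  push_cast
  simp

theorem constantCoeff_theta (r : K⟦X⟧) (j : ℕ) :
    constantCoeff (theta r j)
      = 1 - LaurentPolynomial.C (constantCoeff r ^ (3 * j)) * LaurentPolynomial.T 1 := by
  rw [theta, bilateral, constantCoeff_formalSum]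
  have he : ∀ c : K⟦X⟧, constantCoeff (emb c) = LaurentPolynomial.C (constantCoeff c) := by
    intro c
    rw [← coeff_zero_eq_constantCoeff_apply, emb, coeff_map, coeff_zero_eq_constantCoeff_apply]
  simp only [Nat.cast_zero, neg_zero, zero_add, thetaCoeff_zero, thetaCoeff_one, map_add, map_mul,
    map_one, mono, constantCoeff_C, he, map_neg, map_pow, LaurentPolynomial.T_zero]
  ring

theorem constantCoeff_theta_succ {r : K⟦X⟧} (hr : X ∣ r) (j : ℕ) :
    constantCoeff (theta r (j + 1)) = 1 := by
  rw [constantCoeff_theta, X_dvd_iff.1 hr, zero_pow (by omega), map_zero, zero_mul, sub_zero]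

theorem constantCoeff_evalOne_theta_one {r : K⟦X⟧} (hr : X ∣ r) :
    constantCoeff (evalOne (theta r 1)) = 1 := by
  rw [evalOne, ← coeff_zero_eq_constantCoeff_apply, coeff_map, coeff_zero_eq_constantCoeff_apply,
    constantCoeff_theta_succ hr, map_one]

theorem constantCoeff_derivOne_theta_zero (r : K⟦X⟧) :
    constantCoeff (derivOne (theta r 0)) = -1 := by
  rw [theta, derivOne_bilateral, constantCoeff_formalSum]
  simp [thetaCoeff_zero, thetaCoeff_one]

theorem ne_zero_of_constantCoeff {f : K⟦X⟧} (h : constantCoeff f ≠ 0) : f ≠ 0 := by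
  rintro rfl
  exact h (map_zero _)

theorem emb_injective : Function.Injective (emb : K⟦X⟧ → LaurentPS K) := fun a b h => by
  rw [← evalOne_emb a, h, evalOne_emb]

theorem emb_X : (emb X : LaurentPS K) = X := map_X _

/-- The relation between the cubes and the product of the three theta functions. -/
theorem theta_cubic {r : K⟦X⟧} (hr : X ∣ r) (hr0 : r ≠ 0)
    (hnome : X * (6 * derivOne (theta r 1) - evalOne (theta r 1)) = r * derivOne (theta r 0)) :
    X * (theta r 1 ^ 3 - mono 1 * theta r 2 ^ 3 - emb (r ^ 3) * (mono (-1) * theta r 0 ^ 3))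
      = emb r * (theta r 0 * theta r 1 * theta r 2) := by
  have hq : r ^ 3 ≠ 0 := pow_ne_zero 3 hr0
  set α := theta r 0 with hα
  set β := theta r 1 with hβ
  set γ := theta r 2 with hγ
  have hu : (mono 1 * mono (-1) : LaurentPS K) = 1 := by
    rw [mono_mul_mono, add_neg_cancel, mono_zero]
  -- The image of u⁻¹ alone would be r⁻³u⁻¹, so the factor r³ is kept with it.
  have hu2 : QShift (r ^ 3) (emb (r ^ 3) * mono (-1) : LaurentPS K) (mono (-1)) := by
    intro n
    rw [ucoeff_emb_mul_mono, ucoeff_mono]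
    split_ifs with h
    · simp [h]
    · simp
  have sα : QShift (r ^ 3) α β := qShift_theta hr (Nat.zero_le 1)
  have sβ : QShift (r ^ 3) β γ := qShift_theta hr le_rfl
  have sγ : QShift (r ^ 3) γ (-(mono (-1) * α)) := qShift_theta_two hr
  set f := β ^ 3 - mono 1 * γ ^ 3 - emb (r ^ 3) * (mono (-1) * α ^ 3) with hf
  set g := α * β * γ with hg
  -- The shift α → β → γ → −u⁻¹α permutes the three cubes cyclically, up to the factor −u⁻¹.
  have sf : QShift (r ^ 3) f (emb (-1) * (mono (-1) * f)) := by
    have h := ((sβ.pow hq 3).sub (QShift.mono_one.mul hq (sγ.pow hq 3))).sub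
      (hu2.mul hq (sα.pow hq 3))
    convert h using 1
    · rw [hf]; ring
    · rw [hf, map_neg, map_one]
      linear_combination (γ ^ 3 - emb (r ^ 3) * α ^ 3 * mono (-1) ^ 2) * hu
  have sg : QShift (r ^ 3) g (emb (-1) * (mono (-1) * g)) := by
    have h := (sα.mul hq sβ).mul hq sγ
    convert h using 1
    rw [hg, map_neg, map_one]
    ring
  -- `f` and `g` solve the same equation, and in this combination the coefficient of u⁰ cancels.
  have hzero : emb (ucoeff 0 f) * g - emb (ucoeff 0 g) * f = 0 := by
    refine eq_zero_of_qShift (q := r ^ 3) (c := -1) (by simp) ?_ ?_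
    · convert (sg.emb_mul (ucoeff 0 f)).sub (sf.emb_mul (ucoeff 0 g)) using 1
      ring
    · rw [map_sub, ucoeff_emb_mul, ucoeff_emb_mul]
      ring
  have hα0 : evalOne α = 0 := evalOne_theta_zero r
  have hγ0 : evalOne γ = evalOne β := evalOne_theta_two hr
  have hγ1 : derivOne γ = -derivOne β := derivOne_theta_two hr
  have hα1 : derivOne α ≠ 0 := ne_zero_of_constantCoeff (by
    rw [constantCoeff_derivOne_theta_zero]; simp)
  have hβ0 : evalOne β ≠ 0 := ne_zero_of_constantCoeff (by
    rw [constantCoeff_evalOne_theta_one hr]; simp)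
  have hg0 : ucoeff 0 g ≠ 0 := ne_zero_of_constantCoeff (by
    rw [← coeff_zero_eq_constantCoeff_apply, coeff_ucoeff, coeff_zero_eq_constantCoeff_apply, hg,
      map_mul, map_mul, constantCoeff_theta_succ hr, constantCoeff_theta_succ hr,
      constantCoeff_theta]
    simp)
  have df : derivOne f = evalOne β ^ 2 * (6 * derivOne β - evalOne β) := by
    rw [hf, map_sub, map_sub, derivOne_emb_mul, derivOne_mul, derivOne_mul, derivOne_pow,
      derivOne_pow, derivOne_pow, derivOne_mono, map_pow, map_pow, hα0, hγ0, hγ1, evalOne_mono]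
    push_cast
    ring
  have dg : derivOne g = derivOne α * evalOne β ^ 2 := by
    rw [hg, derivOne_mul, derivOne_mul, map_mul, hα0, hγ0]
    ring
  have hd := congrArg derivOne hzero
  rw [map_zero, map_sub, derivOne_emb_mul, derivOne_emb_mul, df, dg] at hd
  -- Both `f` and `g` vanish at u = 1, so their ratio is read off from the derivatives there: β²(6β'
  -- − β) and α'β². The nome equation evaluates it.
  have hfg : X * ucoeff 0 f = ucoeff 0 g * r := by
    refine mul_left_cancel₀ (mul_ne_zero hα1 (pow_ne_zero 2 hβ0)) ?_
    linear_combination X * hd + ucoeff 0 g * evalOne β ^ 2 * hnome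
  have hfg' := congrArg emb hfg
  rw [map_mul, map_mul, emb_X] at hfg'
  refine mul_left_cancel₀ (fun h => hg0 (emb_injective (h.trans (map_zero emb).symm))) ?_
    (a := emb (ucoeff 0 g))
  linear_combination (-X) * hzero + g * hfg'

end

end WindingSeries

/-! ### Walks on the universal cover and their functional equation. -/

namespace WindingSeries

open PowerSeries

noncomputable section

/-! ### Words and states

The plane without the central triangle is the union of three quadrants, permuted by the rotation of
angle `2π/3`. A state `(k, i, j)` is a point of the universal covering: `i`, `j` are the coordinates
in a quadrant, and `k` is the number of the quadrant. -/

/-- One step: in the direction `1`, `ω` or `ω ^ 2` relative to the current quadrant. -/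
def move : ℤ × ℕ × ℕ → Fin 3 → ℤ × ℕ × ℕ
  | (k, 0, j), 0 => (k + 1, j, 0)
  | (k, i + 1, j), 0 => (k, i, j)
  | (k, i, 0), 1 => (k - 1, 0, i + 1)
  | (k, i, j + 1), 1 => (k, i, j)
  | (k, i, j), 2 => (k, i + 1, j + 1)

/-- The state after all the steps of a word. -/
def endState : (n : ℕ) → (Fin n → Fin 3) → ℤ × ℕ × ℕ
  | 0, _ => (0, 0, 0)
  | n + 1, w => move (endState n (Fin.init w)) (w (Fin.last n))

theorem sum_endState_succ {M : Type*} [AddCommMonoid M] (n : ℕ) (f : ℤ × ℕ × ℕ → M) :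
    ∑ w : Fin (n + 1) → Fin 3, f (endState (n + 1) w)
      = ∑ w : Fin n → Fin 3, ∑ a : Fin 3, f (move (endState n w) a) := by
  rw [← (Fin.snocEquiv fun _ => Fin 3).sum_comp, Fintype.sum_prod_type_right]
  refine Finset.sum_congr rfl fun w _ => Finset.sum_congr rfl fun a _ => ?_
  simp [endState, Fin.snocEquiv]

variable {K : Type*} [Field K]

/-- The constant `s ^ k`. -/
def spow (s : K) (k : ℤ) : LaurentPS K := emb (PowerSeries.C (s ^ k))

theorem spow_add {s : K} (hs : s ≠ 0) (k l : ℤ) : spow s (k + l) = spow s k * spow s l := by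
  rw [spow, spow, spow, ← map_mul, ← map_mul, zpow_add₀ hs]

/-- The contribution of a state to the generating function of all walks. -/
def allTerm (s : K) (x y : LaurentPS K) (σ : ℤ × ℕ × ℕ) : LaurentPS K :=
  spow s σ.1 * x ^ σ.2.1 * y ^ σ.2.2

/-- The contribution of a state to the generating function of the walks ending at `i = 0`. -/
def leftTerm (s : K) (x : LaurentPS K) (σ : ℤ × ℕ × ℕ) : LaurentPS K :=
  if σ.2.1 = 0 then spow s σ.1 * x ^ σ.2.2 else 0

/-- The contribution of a state to the generating function of the walks ending at `j = 0`. -/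
def bottomTerm (s : K) (x : LaurentPS K) (σ : ℤ × ℕ × ℕ) : LaurentPS K :=
  if σ.2.2 = 0 then spow s σ.1 * x ^ σ.2.1 else 0

/-- The generating function of the walks ending at `i = 0`. -/
def leftSeries (s : K) (x : LaurentPS K) : LaurentPS K :=
  formalSum fun n => X ^ n * ∑ w : Fin n → Fin 3, leftTerm s x (endState n w)

/-- The generating function of the walks ending at `j = 0`. -/
def bottomSeries (s : K) (x : LaurentPS K) : LaurentPS K :=
  formalSum fun n => X ^ n * ∑ w : Fin n → Fin 3, bottomTerm s x (endState n w)

/-- The generating function of the walks ending at `i = j = 0`. -/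
def originSeries (s : K) : K⟦X⟧ :=
  formalSum fun n => X ^ n * ∑ w : Fin n → Fin 3,
    if (endState n w).2 = (0, 0) then PowerSeries.C (s ^ (endState n w).1) else 0

/-- Inside a sector the steps multiply by x⁻¹, y⁻¹ and xy. The last four terms correct the steps
that leave it: (0, j) goes to (j, 0) in the next sector, and (i, 0) to (0, i + 1) in the previous
one. The factor xy avoids inverting x and y. -/
theorem sum_allTerm_move {s : K} (hs : s ≠ 0) (x y : LaurentPS K) (σ : ℤ × ℕ × ℕ) :
    x * y * ∑ a : Fin 3, allTerm s x y (move σ a)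
      = (x ^ 2 * y ^ 2 + x + y) * allTerm s x y σ - y * leftTerm s y σ - x * bottomTerm s x σ
        + spow s 1 * x * y * leftTerm s x σ + spow s (-1) * x * y ^ 2 * bottomTerm s y σ := by
  obtain ⟨k, i, j⟩ := σ
  rw [Fin.sum_univ_three]
  rcases i with _ | i <;> rcases j with _ | j <;>
    simp [move, allTerm, leftTerm, bottomTerm, spow_add hs, sub_eq_add_neg] <;> ring

/-- The functional equation on the curve where the kernel vanishes. -/
theorem functional_equation {s : K} (hs : s ≠ 0) {x y : LaurentPS K}
    (hker : x * y = X * (x ^ 2 * y ^ 2 + x + y)) :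
    X * (-(y * leftSeries s y) - x * bottomSeries s x + spow s 1 * x * y * leftSeries s x
      + spow s (-1) * x * y ^ 2 * bottomSeries s y) + x * y = 0 := by
  -- On the kernel curve the bulk term of one length is the bulk term of the preceding length plus
  -- boundary terms. The sum telescopes, with a remainder divisible by `X ^ N`.
  have hstep : ∀ n : ℕ, x * y * (X ^ (n + 1) * ∑ w, allTerm s x y (endState (n + 1) w))
      = x * y * (X ^ n * ∑ w, allTerm s x y (endState n w))
        + X * (-(y * (X ^ n * ∑ w, leftTerm s y (endState n w)))
          - x * (X ^ n * ∑ w, bottomTerm s x (endState n w))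
          + spow s 1 * x * y * (X ^ n * ∑ w, leftTerm s x (endState n w))
          + spow s (-1) * x * y ^ 2 * (X ^ n * ∑ w, bottomTerm s y (endState n w))) := by
    intro n
    rw [sum_endState_succ]
    have := congrArg (fun z => X ^ (n + 1) * z) (Finset.sum_congr rfl fun w _ =>
      sum_allTerm_move hs x y (endState n w) :
        ∑ w : Fin n → Fin 3, x * y * ∑ a : Fin 3, allTerm s x y (move (endState n w) a) = _)
    simp only [Finset.sum_add_distrib, Finset.sum_sub_distrib, ← Finset.mul_sum] at this
    linear_combination this - X ^ n * (∑ w, allTerm s x y (endState n w)) * hker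
  have hsum : ∀ N : ℕ, x * y * (X ^ N * ∑ w, allTerm s x y (endState N w))
      = x * y + X * (-(y * ∑ n ∈ Finset.range N, X ^ n * ∑ w, leftTerm s y (endState n w))
          - x * ∑ n ∈ Finset.range N, X ^ n * ∑ w, bottomTerm s x (endState n w)
          + spow s 1 * x * y * ∑ n ∈ Finset.range N, X ^ n * ∑ w, leftTerm s x (endState n w)
          + spow s (-1) * x * y ^ 2 *
            ∑ n ∈ Finset.range N, X ^ n * ∑ w, bottomTerm s y (endState n w)) := by
    intro N
    induction N with
    | zero => simp [endState, allTerm, spow]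
    | succ N ih =>
      rw [hstep, ih]
      simp only [Finset.sum_range_succ]
      ring
  refine eq_of_forall_X_pow_dvd_sub fun N => ?_
  have d : ∀ F : ℕ → LaurentPS K, X ^ N ∣ formalSum (fun n => X ^ n * F n)
      - ∑ n ∈ Finset.range N, X ^ n * F n :=
    fun F => formalSum_sub_dvd (fun n => dvd_mul_right _ _) N
  have d1 := (d fun n => ∑ w, leftTerm s y (endState n w)).mul_left (-(X * y))
  have d2 := (d fun n => ∑ w, bottomTerm s x (endState n w)).mul_left (-(X * x))
  have d3 := (d fun n => ∑ w, leftTerm s x (endState n w)).mul_left (X * (spow s 1 * x * y))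
  have d4 := (d fun n => ∑ w, bottomTerm s y (endState n w)).mul_left
    (X * (spow s (-1) * x * y ^ 2))
  have d5 := dvd_mul_right (X ^ N : LaurentPS K) (x * y * ∑ w, allTerm s x y (endState N w))
  have := dvd_add (dvd_add (dvd_add (dvd_add d1 d2) d3) d4) d5
  convert this using 1
  simp only [leftSeries, bottomSeries]
  linear_combination (-1) * hsum N

theorem QShift.spow {q : K⟦X⟧} (s : K) (k : ℤ) :
    QShift q (WindingSeries.spow s k) (WindingSeries.spow s k) := QShift.emb _

theorem qShift_leftSeries {q : K⟦X⟧} (hq : q ≠ 0) (s : K) {x y : LaurentPS K} (h : QShift q x y) :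
    QShift q (leftSeries s x) (leftSeries s y) := by
  refine QShift.formalSum (fun n => dvd_mul_right _ _) (fun n => dvd_mul_right _ _) fun n => ?_
  rw [← emb_X, ← map_pow]
  refine QShift.emb_mul _ (QShift.sum fun w _ => ?_)
  rw [leftTerm, leftTerm]
  split_ifs
  · exact (QShift.spow s _).mul hq (h.pow hq _)
  · exact QShift.zero

theorem qShift_bottomSeries {q : K⟦X⟧} (hq : q ≠ 0) (s : K) {x y : LaurentPS K}
    (h : QShift q x y) : QShift q (bottomSeries s x) (bottomSeries s y) := by
  refine QShift.formalSum (fun n => dvd_mul_right _ _) (fun n => dvd_mul_right _ _) fun n => ?_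
  rw [← emb_X, ← map_pow]
  refine QShift.emb_mul _ (QShift.sum fun w _ => ?_)
  rw [bottomTerm, bottomTerm]
  split_ifs
  · exact (QShift.spow s _).mul hq (h.pow hq _)
  · exact QShift.zero

/-- Where x vanishes, only i = 0 survives among the states with j = 0. -/
theorem evalOne_bottomSeries (s : K) {x : LaurentPS K} (hx : evalOne x = 0) :
    evalOne (bottomSeries s x) = originSeries s := by
  rw [bottomSeries, originSeries]
  conv_lhs => rw [evalOne, map_formalSum]
  congr 1
  ext1 n
  change evalOne _ = _
  rw [map_mul, map_pow, ← emb_X, evalOne_emb, map_sum]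
  congr 1
  refine Finset.sum_congr rfl fun w _ => ?_
  obtain ⟨k, i, j⟩ := endState n w
  rcases i with _ | i <;> rcases j with _ | j <;> simp [bottomTerm, spow, evalOne_emb, hx]

end

end WindingSeries

/-! ### Solving the functional equation at the theta parametrization. -/

namespace WindingSeries

open PowerSeries

noncomputable section

variable {K : Type*} [Field K]

/-! ### The quadratic theta function -/

/-- The coefficients of `auxTheta`. -/
def auxCoeff (r : K⟦X⟧) (s : K) (n : ℤ) : K⟦X⟧ :=
  sgn n * PowerSeries.C (s ^ (1 - n)) * r ^ (3 * tri n + 2 * n).toNat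

/-- The theta function with nome `r ^ 3` whose product with `u` satisfies
`f(r ^ 3 * u) = -s * r * u⁻¹ * f(u)`. -/
def auxTheta (r : K⟦X⟧) (s : K) : LaurentPS K := bilateral (auxCoeff r s)

theorem aux_exp_nonneg (n : ℤ) : 0 ≤ 3 * tri n + 2 * n := by
  have h1 := two_mul_tri n
  have h2 := tri_nonneg n
  rcases le_or_gt 0 n with h | h
  · positivity
  · nlinarith

theorem decays_auxCoeff {r : K⟦X⟧} (hr : X ∣ r) (s : K) : Decays (auxCoeff r s) := by
  intro m
  obtain ⟨h1, h2⟩ := natCast_le_tri_add m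
  have h3 := tri_nonneg m
  refine ⟨(X_pow_dvd_pow hr ?_).mul_left _, (X_pow_dvd_pow hr ?_).mul_left _⟩
  · rw [tri_neg]
    omega
  · rw [tri_succ]
    omega

/-- With Θ of nome r³, `auxTheta` is sΘ(s⁻¹r²u), and Θ(r³z) = −z⁻¹Θ(z). The factor u turns the
multiplier −s r⁻²u⁻¹ into −s r u⁻¹. -/
theorem qShift_auxTheta {r : K⟦X⟧} (hr : X ∣ r) {s : K} (hs : s ≠ 0) :
    QShift (r ^ 3) (mono 1 * auxTheta r s)
      (emb (-(PowerSeries.C s * r)) * (mono (-1) * (mono 1 * auxTheta r s))) := by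
  intro n
  rw [ucoeff_emb_mul, ucoeff_mono_mul, ucoeff_mono_mul, ucoeff_mono_mul, auxTheta,
    ucoeff_bilateral (decays_auxCoeff hr s), ucoeff_bilateral (decays_auxCoeff hr s)]
  obtain ⟨n, rfl⟩ : ∃ k, n = k + 1 := ⟨n - 1, by ring⟩
  have h1 := aux_exp_nonneg n
  have h2 := aux_exp_nonneg (n + 1)
  rw [show n + 1 - -1 - 1 = n + 1 by ring, show n + 1 - 1 = n by ring, auxCoeff, auxCoeff,
    sgn_succ, show 1 - n = 1 + (1 - (n + 1)) by ring, zpow_add₀ hs, zpow_one, map_mul]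
  rw [tri_succ] at h2 ⊢
  have e : (r ^ 3) ^ (-(n + 1)).toNat * (r * r ^ (3 * (tri n + n) + 2 * (n + 1)).toNat)
      = (r ^ 3) ^ (n + 1).toNat * r ^ (3 * tri n + 2 * n).toNat := by
    rw [← pow_succ', ← pow_mul, ← pow_mul, ← pow_add, ← pow_add]
    congr 1
    omega
  linear_combination sgn n * PowerSeries.C s * PowerSeries.C (s ^ (1 - (n + 1))) * e

theorem constantCoeff_evalOne_auxTheta {r : K⟦X⟧} (hr : X ∣ r) (s : K) :
    constantCoeff (evalOne (auxTheta r s)) = s := by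
  rw [auxTheta, evalOne_bilateral, constantCoeff_formalSum]
  simp [auxCoeff, sgn_zero, sgn_one, tri_zero, tri_one, X_dvd_iff.1 hr]

theorem ucoeff_zero_auxTheta_ne_zero {r : K⟦X⟧} (hr : X ∣ r) (hr0 : r ≠ 0) {s : K} (hs : s ≠ 0) :
    ucoeff 0 (mono 1 * auxTheta r s) ≠ 0 := by
  rw [ucoeff_mono_mul, auxTheta, ucoeff_bilateral (decays_auxCoeff hr s), auxCoeff]
  refine mul_ne_zero (mul_ne_zero (pow_ne_zero _ (neg_ne_zero.2 one_ne_zero)) ?_)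
    (pow_ne_zero _ hr0)
  rw [Ne, map_eq_zero_iff _ PowerSeries.C_injective]
  exact zpow_ne_zero _ hs

/-! ### Solution of the functional equation -/

/-- The generating function of the walks ending at the origin, in terms of theta functions. -/
theorem originSeries_theta {r : K⟦X⟧} (hr : X ∣ r) (hr0 : r ≠ 0) {s : K} (hs : s ≠ 0)
    (hnome : X * (6 * derivOne (theta r 1) - evalOne (theta r 1)) = r * derivOne (theta r 0)) :
    ((1 - PowerSeries.C s ^ 3) * X * r * derivOne (theta r 0) * originSeries s
      - r * PowerSeries.C s ^ 2 * derivOne (theta r 0) + PowerSeries.C s * evalOne (theta r 1)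
      - PowerSeries.C s * derivOne (theta r 1)) * evalOne (auxTheta r s)
    = PowerSeries.C s * evalOne (theta r 1)
      * (evalOne (auxTheta r s) + derivOne (auxTheta r s)) := by
  have hq : r ^ 3 ≠ 0 := pow_ne_zero 3 hr0
  have hcubic := theta_cubic hr hr0 hnome
  have sα : QShift (r ^ 3) (theta r 0) (theta r 1) := qShift_theta hr (Nat.zero_le 1)
  have sβ : QShift (r ^ 3) (theta r 1) (theta r 2) := qShift_theta hr le_rfl
  have sγ : QShift (r ^ 3) (theta r 2) (-(mono (-1) * theta r 0)) := qShift_theta_two hr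
  have hα0 : evalOne (theta r 0) = 0 := evalOne_theta_zero r
  have hγ0 := evalOne_theta_two hr
  have hγ1 := derivOne_theta_two hr
  have hβ0 : evalOne (theta r 1) ≠ 0 := ne_zero_of_constantCoeff (by
    rw [constantCoeff_evalOne_theta_one hr]; simp)
  have hβX : X ∣ 1 - theta r 1 := X_dvd_iff.2 (by
    rw [map_sub, map_one, constantCoeff_theta_succ hr 0, sub_self])
  have hγX : X ∣ 1 - theta r 2 := X_dvd_iff.2 (by
    rw [map_sub, map_one, constantCoeff_theta_succ hr 1, sub_self])
  -- β and γ have constant term 1 and are invertible. α has constant term 1 − u and is not, so it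
  -- never appears in a denominator.
  obtain ⟨β', hβ'⟩ : ∃ β', theta r 1 * β' = 1 := (isUnit_iff_constantCoeff.2 (by
    rw [constantCoeff_theta_succ hr 0]; exact isUnit_one)).exists_right_inv
  obtain ⟨γ', hγ'⟩ : ∃ γ', theta r 2 * γ' = 1 := (isUnit_iff_constantCoeff.2 (by
    rw [constantCoeff_theta_succ hr 1]; exact isUnit_one)).exists_right_inv
  have sβ' : QShift (r ^ 3) β' γ' := sβ.inv hq hβ' hγ' hβX hγX
  have hu : (mono 1 * mono (-1) : LaurentPS K) = 1 := by
    rw [mono_mul_mono, add_neg_cancel, mono_zero]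
  have su : QShift (r ^ 3) (mono 1 : LaurentPS K) (emb (r ^ 3) * mono 1) := QShift.mono_one
  set α := theta r 0
  set β := theta r 1
  set γ := theta r 2
  set R := emb r with hR
  have hR3 : emb (r ^ 3) = R ^ 3 := map_pow _ _ _
  rw [hR3] at hcubic su
  set U : LaurentPS K := mono 1 with hU
  set U' : LaurentPS K := mono (-1) with hU'
  set x := R * α * γ * β' ^ 2 with hx
  set y := -(R * U' * α * β * γ' ^ 2) with hy
  -- With c = r u⁻¹αβ⁻²γ⁻², one has x = c uγ³, y = −cβ³, x²y² = c r³u⁻¹α³ and xy = −c r αβγ. The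
  -- kernel equation is thus −c times the cubic relation.
  have hker : x * y = X * (x ^ 2 * y ^ 2 + x + y) := by
    have e1 : x * y = -(R ^ 2 * U' * α ^ 2 * β' * γ') := by
      rw [hx, hy]
      linear_combination (-(R ^ 2 * U' * α ^ 2 * β' * γ') * (γ * γ')) * hβ'
        - (R ^ 2 * U' * α ^ 2 * β' * γ') * hγ'
    have e2 : x = R * α * U' * β' ^ 2 * γ' ^ 2 * (U * γ ^ 3) := by
      rw [hx]
      linear_combination (-(R * α * γ * β' ^ 2)) * (γ * γ' + 1) * hγ'
        - R * α * γ * β' ^ 2 * γ ^ 2 * γ' ^ 2 * hu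
    have e3 : y = -(R * α * U' * β' ^ 2 * γ' ^ 2 * β ^ 3) := by
      rw [hy]
      linear_combination (R * U' * α * β * γ' ^ 2) * (β * β' + 1) * hβ'
    have e4 : x ^ 2 * y ^ 2 = R ^ 4 * U' ^ 2 * α ^ 4 * β' ^ 2 * γ' ^ 2 := by
      rw [← mul_pow, e1]; ring
    rw [e1, e4]
    nth_rewrite 1 [e2]
    rw [e3]
    linear_combination (R * α * U' * β' ^ 2 * γ' ^ 2) * hcubic
      + (R ^ 2 * U' * α ^ 2 * β' * γ') * (γ * γ') * hβ'
      + (R ^ 2 * U' * α ^ 2 * β' * γ') * hγ'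
  have sx : QShift (r ^ 3) x y := by
    have h := (((QShift.emb r).mul hq sα).mul hq sγ).mul hq (sβ'.pow hq 2)
    convert h using 1
    rw [hy]
    ring
  have hx0 : evalOne x = 0 := by rw [hx]; simp only [map_mul, hα0, mul_zero, zero_mul]
  have hFE := functional_equation hs hker
  have sA := qShift_leftSeries hq s sx
  have sB := qShift_bottomSeries hq s sx
  have hB0 := evalOne_bottomSeries s hx0
  set A₁ := leftSeries s x
  set A₂ := leftSeries s y
  set B₁ := bottomSeries s x
  set B₂ := bottomSeries s y
  have hss : spow s 1 * spow s (-1) = 1 := by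
    rw [← spow_add hs, add_neg_cancel, spow, zpow_zero, map_one, map_one]
  have hS : spow s 1 = emb (PowerSeries.C s) := by rw [spow, zpow_one]
  set S := spow s 1 with hSdef
  have sS : QShift (r ^ 3) S S := QShift.spow s 1
  have sR : QShift (r ^ 3) R R := QShift.emb r
  have sX : QShift (r ^ 3) (X : LaurentPS K) X := by rw [← emb_X]; exact QShift.emb _
  -- After multiplication of the functional equation by −sβγ², the terms in A(x), B(x) collect to s
  -- r u⁻¹W₁ and those in A(y), B(y) to W₂, each up to the factor t. The point is that W₂ is again
  -- the shift of W₁.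
  set W₁ := R * S * α ^ 2 * γ * A₁ + U * α * γ ^ 3 * β' * B₁ with hW₁
  set W₂ := -(R * S * U' * α * β ^ 2 * A₂) - R ^ 3 * U' ^ 2 * β * α ^ 3 * γ' * B₂ with hW₂
  have sW : QShift (r ^ 3) W₁ W₂ := by
    have h := ((((sR.mul hq sS).mul hq (sα.pow hq 2)).mul hq sγ).mul hq sA).add
      ((((su.mul hq sα).mul hq (sγ.pow hq 3)).mul hq sβ').mul hq sB)
    convert h using 1
    rw [hW₂]
    linear_combination (R ^ 3 * U' ^ 2 * β * α ^ 3 * γ' * B₂) * hu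
  have hW : X * W₂ + S * R * U' * (X * W₁ + R * α ^ 2 * γ) = 0 := by
    have ey : β * γ ^ 2 * y = -(R * U' * α * β ^ 2) := by
      rw [hy]
      linear_combination (-(R * U' * α * β ^ 2)) * (γ * γ' + 1) * hγ'
    have ex : β * γ ^ 2 * x = R * α * γ ^ 3 * β' := by
      rw [hx]
      linear_combination (R * α * γ ^ 3 * β') * hβ'
    have exy : β * γ ^ 2 * (x * y) = -(R ^ 2 * U' * α ^ 2 * γ) := by
      linear_combination x * ey - (R * U' * α * β ^ 2) * hx
        - (R ^ 2 * U' * α ^ 2 * γ) * (β * β' + 1) * hβ'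
    have exyy : β * γ ^ 2 * (x * y ^ 2) = R ^ 3 * U' ^ 2 * α ^ 3 * β * γ' := by
      have : γ * y = -(R * U' * α * β * γ') := by
        rw [hy]
        linear_combination (-(R * U' * α * β * γ')) * hγ'
      linear_combination y * exy - (R ^ 2 * U' * α ^ 2) * this
    linear_combination (-S * β * γ ^ 2) * hFE - (S * X * A₂) * ey - (S * X * B₁) * ex
      + (S ^ 2 * X * A₁ + S) * exy + (S * spow s (-1) * X * B₂) * exyy
      + (X * R ^ 3 * U' ^ 2 * α ^ 3 * β * γ' * B₂) * hss
      + (S * R * X * α * γ ^ 3 * β' * B₁) * hu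
  -- The shift takes α²γ to −u⁻¹αβ², αβ² to βγ², and βγ² to u⁻²α²γ. The weights are chosen so that
  -- only an α²γ defect, with factor 1 − s³, remains; it is the inhomogeneous term of the equation
  -- for W.
  set V₁ := (1 - S ^ 3) * X * R * W₁ - (R ^ 2 * S ^ 3 * α ^ 2 * γ + R * S ^ 2 * α * β ^ 2
    - S * U * β * γ ^ 2) with hV₁
  have sV : QShift (r ^ 3) V₁ (emb (-(PowerSeries.C s * r)) * (U' * V₁)) := by
    have h := ((((QShift.one.sub (sS.pow hq 3)).mul hq sX).mul hq sR).mul hq sW).sub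
      (((((sR.pow hq 2).mul hq (sS.pow hq 3)).mul hq (sα.pow hq 2)).mul hq sγ).add
        (((sR.mul hq (sS.pow hq 2)).mul hq sα).mul hq (sβ.pow hq 2)) |>.sub
        (((sS.mul hq su).mul hq sβ).mul hq (sγ.pow hq 2)))
    convert h using 1
    rw [map_neg, map_mul, ← hS, ← hR, hV₁]
    linear_combination (-(1 - S ^ 3) * R) * hW
      + (-(S * R ^ 3 * U' * γ * α ^ 2) - S ^ 2 * R * β * γ ^ 2) * hu
  have sH := qShift_auxTheta hr hs
  set H := U * auxTheta r s with hH
  have hzero : emb (ucoeff 0 H) * V₁ - emb (ucoeff 0 V₁) * H = 0 := by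
    refine eq_zero_of_qShift (q := r ^ 3) (c := -(PowerSeries.C s * r)) ?_ ?_ ?_
    · refine neg_ne_zero.2 (mul_ne_zero ?_ hr0)
      rwa [Ne, map_eq_zero_iff _ PowerSeries.C_injective]
    · convert (sV.emb_mul (ucoeff 0 H)).sub (sH.emb_mul (ucoeff 0 V₁)) using 1
      ring
    · rw [map_sub, ucoeff_emb_mul, ucoeff_emb_mul]
      ring
  have hH0 : ucoeff 0 H ≠ 0 := ucoeff_zero_auxTheta_ne_zero hr hr0 hs
  have eH : evalOne H = evalOne (auxTheta r s) := by
    rw [hH, map_mul, hU, evalOne_mono, one_mul]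
  have dH : derivOne H = evalOne (auxTheta r s) + derivOne (auxTheta r s) := by
    rw [hH, derivOne_mul, hU, evalOne_mono, derivOne_mono]
    push_cast
    ring
  have eX : evalOne (X : LaurentPS K) = X := by rw [← emb_X, evalOne_emb]
  have dX : derivOne (X : LaurentPS K) = 0 := by rw [← emb_X, derivOne_emb]
  have eR : evalOne R = r := evalOne_emb r
  have dR : derivOne R = 0 := derivOne_emb r
  have eS : evalOne S = PowerSeries.C s := by rw [hS, evalOne_emb]
  have dS : derivOne S = 0 := by rw [hS, derivOne_emb]
  have eU : evalOne U = 1 := evalOne_mono 1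
  have dU : derivOne U = 1 := by rw [hU, derivOne_mono]; simp
  -- At u = 1 every term with a factor α drops out, and γ = β.
  have eV : evalOne V₁ = PowerSeries.C s * evalOne β ^ 3 := by
    rw [hV₁, hW₁]
    simp only [map_sub, map_add, map_mul, map_pow, hα0, eU, hγ0, eS]
    ring
  have hβ'0 : evalOne β * evalOne β' = 1 := by rw [← map_mul, hβ', map_one]
  -- Only the term of first order in α contributes. There B(x) is evaluated at x = 0, so the unknown
  -- A disappears.
  have dW : derivOne W₁ = derivOne α * evalOne β ^ 2 * originSeries s := by
    rw [hW₁, pow_two]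
    simp only [map_add, derivOne_mul, map_mul, map_pow, hα0, eU, hγ0, hB0]
    linear_combination (derivOne α * evalOne β ^ 2 * originSeries s) * hβ'0
  have d1 : derivOne (1 : LaurentPS K) = 0 := by rw [← mono_zero, derivOne_mono]; simp
  have dV : derivOne V₁ = evalOne β ^ 2 * ((1 - PowerSeries.C s ^ 3) * X * r * derivOne α
      * originSeries s - r * PowerSeries.C s ^ 2 * derivOne α + PowerSeries.C s * evalOne β
      - PowerSeries.C s * derivOne β) := by
    have eW : evalOne W₁ = 0 := by
      rw [hW₁]
      simp only [map_add, map_mul, map_pow, hα0]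
      ring
    rw [hV₁]
    simp only [map_sub, map_add, derivOne_mul, map_mul, map_one, hα0, eU, hγ0, eS, eR, dR, dS,
      dU, eX, dX, pow_two, hγ1, dW, eW, d1, pow_succ _ 2]
    ring
  -- V and H are proportional, so V'(1) H(1) = V(1) H'(1).
  have he := congrArg evalOne hzero
  have hd := congrArg derivOne hzero
  rw [map_zero, map_sub, map_mul evalOne, map_mul evalOne, evalOne_emb, evalOne_emb, eV, eH] at he
  rw [map_zero, map_sub derivOne, derivOne_emb_mul, derivOne_emb_mul, dV, dH] at hd
  refine mul_left_cancel₀ (mul_ne_zero hH0 (pow_ne_zero 2 hβ0)) ?_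
  linear_combination evalOne (auxTheta r s) * hd
    - (evalOne (auxTheta r s) + derivOne (auxTheta r s)) * he

end

end WindingSeries

/-! ### From theta values at u = 1 to the series T in ℚ(s)((t)). -/

namespace WindingSeries

open PowerSeries KrewerasWinding

noncomputable section

/-! ### Convergence in the field of Laurent series -/

/-- The inclusion of power series in Laurent series. -/
abbrev toL : (RatFunc ℚ)⟦X⟧ →+* L := HahnSeries.ofPowerSeries ℤ (RatFunc ℚ)

theorem toL_injective : Function.Injective toL := HahnSeries.ofPowerSeries_injective

theorem toL_X : toL X = t := HahnSeries.ofPowerSeries_X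

theorem toL_C (a : RatFunc ℚ) : toL (PowerSeries.C a) = HahnSeries.C a :=
  HahnSeries.ofPowerSeries_C a

theorem valuation_toL_le {f : (RatFunc ℚ)⟦X⟧} {N : ℕ} (h : X ^ N ∣ f) :
    Valued.v (toL f) ≤ WithZero.exp (-(N : ℤ)) := by
  rw [LaurentSeries.valuation_le_iff_coeff_lt_eq_zero]
  intro n hn
  rw [PowerSeries.coeff_coe]
  split_ifs with h0
  · rfl
  · exact X_pow_dvd_iff.1 h _ (by omega)

/-- The bridge from formal sums to topological ones: outside `range N` all terms have valuation at
most that of `t ^ N`, so the sum converges unconditionally. -/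
theorem hasSum_toL {f : ℕ → (RatFunc ℚ)⟦X⟧} (hf : ∀ n, X ^ n ∣ f n) :
    HasSum (fun n => toL (f n)) (toL (formalSum f)) := by
  rw [HasSum, Filter.tendsto_def]
  intro U hU
  obtain ⟨γ, hγ⟩ := Valued.mem_nhds.1 hU
  obtain ⟨N, hN⟩ : ∃ N : ℕ, WithZero.exp (-(N : ℤ))
      < MonoidWithZeroHom.ValueGroup₀.embedding γ.1 := by
    refine ⟨(-(WithZero.log (MonoidWithZeroHom.ValueGroup₀.embedding γ.1) - 1)).toNat, ?_⟩
    rw [← WithZero.lt_log_iff_exp_lt (by simp)]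
    omega
  rw [SummationFilter.unconditional_filter, Filter.mem_atTop_sets]
  refine ⟨Finset.range N, fun a ha => hγ ?_⟩
  rw [Set.mem_ofPred_eq, Valuation.restrict_lt_iff_lt_embedding]
  refine lt_of_le_of_lt ?_ hN
  change Valued.v (∑ b ∈ a, toL (f b) - toL (formalSum f)) ≤ _
  rw [← map_sum, ← map_sub]
  refine valuation_toL_le ?_
  rw [dvd_sub_comm, ← Finset.sum_sdiff ha, add_comm, ← sub_sub]
  refine dvd_sub (formalSum_sub_dvd hf N) (Finset.dvd_sum fun i hi => ?_)
  have : N ≤ i := by simpa using (Finset.mem_sdiff.1 hi).2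
  exact (pow_dvd_pow X this).trans (hf i)

/-! ### The series `T` -/

/-- The series `∑ n, (-1)^n (2n+1)^k (a_n - (-1)^k b_n)`. -/
def pairSum (k : ℕ) (a b : ℕ → (RatFunc ℚ)⟦X⟧) : (RatFunc ℚ)⟦X⟧ :=
  formalSum fun n => (-1) ^ n * (2 * (n : (RatFunc ℚ)⟦X⟧) + 1) ^ k * (a n - (-1) ^ k * b n)

/-- The products of `Q ^ (n (n + 1) / 2)` with `u ^ (n + 1)` and `u ^ (-n)` are given, up to the
factor `κ`, by power series tending to zero. -/
def Represents (u Q κ : L) (a b : ℕ → (RatFunc ℚ)⟦X⟧) : Prop :=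
  ∀ n : ℕ, (X ^ n ∣ a n ∧ X ^ n ∣ b n) ∧ Q ^ (n * (n + 1) / 2) * u ^ (n + 1) = κ * toL (a n) ∧
    Q ^ (n * (n + 1) / 2) * u ^ (-(n : ℤ)) = κ * toL (b n)

theorem Represents.hasSum {u Q κ : L} {a b : ℕ → (RatFunc ℚ)⟦X⟧} (h : Represents u Q κ a b)
    (k : ℕ) : HasSum (termT k u Q) (κ * toL (pairSum k a b)) := by
  have := (hasSum_toL (f := fun n => (-1) ^ n * (2 * (n : (RatFunc ℚ)⟦X⟧) + 1) ^ k
    * (a n - (-1) ^ k * b n)) fun n =>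
      (dvd_sub (h n).1.1 ((h n).1.2.mul_left _)).mul_left _).mul_left κ
  have e : termT k u Q = fun n : ℕ => κ * toL ((-1) ^ n * (2 * (n : (RatFunc ℚ)⟦X⟧) + 1) ^ k
      * (a n - (-1) ^ k * b n)) := by
    ext1 n
    obtain ⟨-, h1, h2⟩ := h n
    simp only [termT, map_mul, map_sub, map_pow, map_neg, map_add, map_one, map_natCast,
      map_ofNat]
    linear_combination ((-1) ^ n * (2 * (n : L) + 1) ^ k) * h1
      - ((-1) ^ n * (2 * (n : L) + 1) ^ k * (-1) ^ k) * h2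
  rw [e]
  exact this

theorem Represents.T_eq {u Q κ : L} {a b : ℕ → (RatFunc ℚ)⟦X⟧} (h : Represents u Q κ a b)
    (k : ℕ) : KrewerasWinding.T k u Q = κ * toL (pairSum k a b) := (h.hasSum k).tsum_eq

/-- The coefficients of positive index, with signs. -/
def upper (c : ℤ → (RatFunc ℚ)⟦X⟧) (n : ℕ) : (RatFunc ℚ)⟦X⟧ := -((-1) ^ n * c (n + 1))

/-- The coefficients of nonpositive index, with signs. -/
def lower (c : ℤ → (RatFunc ℚ)⟦X⟧) (n : ℕ) : (RatFunc ℚ)⟦X⟧ := (-1) ^ n * c (-n)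

theorem neg_one_pow_mul_self {A : Type*} [CommRing A] (n : ℕ) : (-1 : A) ^ n * (-1) ^ n = 1 := by
  rw [← mul_pow]; simp

theorem pairSum_zero {c : ℤ → (RatFunc ℚ)⟦X⟧} (hc : Decays c) :
    pairSum 0 (upper c) (lower c) = -evalOne (bilateral c) := by
  rw [evalOne_bilateral, ← neg_one_mul, ← mul_formalSum, pairSum]
  · congr 1
    ext1 n
    rw [upper, lower]
    linear_combination (-(c (-n) + c (n + 1))) * neg_one_pow_mul_self (A := (RatFunc ℚ)⟦X⟧) n
  · exact fun n => dvd_add (hc n).1 (hc n).2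

/-- The operator f − 2f' weights the coefficient of index k by 1 − 2k, which is 2n + 1 at k = −n and
−(2n + 1) at k = n + 1. -/
theorem pairSum_one {c : ℤ → (RatFunc ℚ)⟦X⟧} (hc : Decays c) :
    pairSum 1 (upper c) (lower c) = evalOne (bilateral c) - 2 * derivOne (bilateral c) := by
  rw [evalOne_bilateral, derivOne_bilateral, ← mul_formalSum, ← formalSum_sub, pairSum]
  · congr 1
    ext1 n
    rw [upper, lower]
    linear_combination ((2 * (n : (RatFunc ℚ)⟦X⟧) + 1) * (c (-n) - c (n + 1)))
      * neg_one_pow_mul_self (A := (RatFunc ℚ)⟦X⟧) n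
  · exact fun n => dvd_add ((hc n).1.mul_left _) ((hc n).2.mul_left _)

theorem pairSum_zero_swap {u Q κ : L} {a b : ℕ → (RatFunc ℚ)⟦X⟧} (h : Represents u Q κ a b) :
    pairSum 0 a b = -pairSum 0 b a := by
  rw [pairSum, pairSum, ← neg_one_mul (formalSum _), ← mul_formalSum]
  · congr 1
    ext1 n
    ring
  · exact fun n => (dvd_sub (h n).1.2 ((h n).1.1.mul_left _)).mul_left _

theorem pairSum_one_swap (a b : ℕ → (RatFunc ℚ)⟦X⟧) : pairSum 1 b a = pairSum 1 a b := by
  rw [pairSum, pairSum]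
  congr 1
  ext1 n
  ring

theorem tri_natCast_succ (n : ℕ) : tri (n + 1) = (n * (n + 1) / 2 : ℕ) := by
  rw [tri]
  push_cast
  congr 1
  ring

theorem represents_theta {r : (RatFunc ℚ)⟦X⟧} (hr : X ∣ r) (hr0 : r ≠ 0) {j : ℕ} (hj : j ≤ 2) :
    Represents ((toL r ^ 3) ^ j) ((toL r ^ 3) ^ 3) 1 (upper (thetaCoeff r j))
      (lower (thetaCoeff r j)) := by
  intro n
  have hd := decays_thetaCoeff hr hj n
  have hρ : toL r ≠ 0 := (map_ne_zero_iff toL toL_injective).2 hr0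
  refine ⟨⟨(hd.2.mul_left _).neg_right, hd.1.mul_left _⟩, ?_, ?_⟩
  · have e : upper (thetaCoeff r j) n = r ^ (9 * (n * (n + 1) / 2) + 3 * j * (n + 1)) := by
      rw [upper, thetaCoeff, sgn_succ, sgn_natCast, tri_natCast_succ,
        show (9 * ((n * (n + 1) / 2 : ℕ) : ℤ) + 3 * j * (n + 1)).toNat
          = 9 * (n * (n + 1) / 2) + 3 * j * (n + 1) by
        rw [← Int.toNat_natCast (9 * (n * (n + 1) / 2) + 3 * j * (n + 1))]
        congr 1]
      linear_combination r ^ (9 * (n * (n + 1) / 2) + 3 * j * (n + 1))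
        * neg_one_pow_mul_self (A := (RatFunc ℚ)⟦X⟧) n
    rw [e, one_mul, map_pow]
    ring
  · obtain ⟨e, he⟩ : ∃ e : ℕ, 9 * tri (-n) + 3 * j * (-n : ℤ) = e :=
      Int.eq_ofNat_of_zero_le (thetaCoeff_exp_nonneg hj _)
    have e' : lower (thetaCoeff r j) n = r ^ e := by
      rw [lower, thetaCoeff, sgn_neg, sgn_natCast, he, Int.toNat_natCast]
      linear_combination r ^ e * neg_one_pow_mul_self (A := (RatFunc ℚ)⟦X⟧) n
    rw [tri_neg, ← tri_succ, tri_natCast_succ] at he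
    generalize n * (n + 1) / 2 = d at he ⊢
    have h2 : 3 * (3 * d) = e + 3 * (j * n) := by
      zify
      linarith
    rw [e', one_mul, map_pow, zpow_neg, mul_inv_eq_iff_eq_mul₀
      (zpow_ne_zero _ (pow_ne_zero _ (pow_ne_zero _ hρ))), zpow_natCast,
      ← pow_mul (toL r ^ 3), ← pow_mul, ← pow_mul, ← pow_mul, ← pow_add, ← h2]

/-- The argument s r⁻² of T is inverse to the argument s⁻¹r² in `auxTheta`, so the positive and
nonpositive indices exchange roles. The factor r⁻² absorbs the negative exponents. -/
theorem represents_aux {r : (RatFunc ℚ)⟦X⟧} (hr : X ∣ r) (hr0 : r ≠ 0) :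
    Represents (s * toL r ^ (-2 : ℤ)) (toL r ^ 3) (toL r ^ (-2 : ℤ))
      (lower (auxCoeff r RatFunc.X)) (upper (auxCoeff r RatFunc.X)) := by
  intro n
  have hd := decays_auxCoeff hr RatFunc.X n
  have hρ : toL r ≠ 0 := (map_ne_zero_iff toL toL_injective).2 hr0
  have hs : (HahnSeries.C RatFunc.X : L) ≠ 0 := by
    rw [map_ne_zero_iff _ HahnSeries.C_injective]
    exact RatFunc.X_ne_zero
  have hC : ∀ k : ℤ, toL (PowerSeries.C (RatFunc.X ^ k : RatFunc ℚ)) = s ^ k := by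
    intro k
    rw [toL_C, map_zpow₀]
    rfl
  refine ⟨⟨hd.1.mul_left _, (hd.2.mul_left _).neg_right⟩, ?_, ?_⟩
  · obtain ⟨e, he⟩ : ∃ e : ℕ, 3 * tri (-n) + 2 * (-n : ℤ) = e :=
      Int.eq_ofNat_of_zero_le (aux_exp_nonneg _)
    have e' : lower (auxCoeff r RatFunc.X) n
        = PowerSeries.C (RatFunc.X ^ (1 + n : ℤ)) * r ^ e := by
      rw [lower, auxCoeff, sgn_neg, sgn_natCast, he, Int.toNat_natCast, sub_neg_eq_add]
      linear_combination PowerSeries.C (RatFunc.X ^ (1 + n : ℤ)) * r ^ e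
        * neg_one_pow_mul_self (A := (RatFunc ℚ)⟦X⟧) n
    rw [tri_neg, ← tri_succ, tri_natCast_succ] at he
    generalize n * (n + 1) / 2 = d at he ⊢
    have h2 : 3 * d = e + 2 * n := by omega
    have hn : (s : L) ^ (1 + n : ℤ) = s ^ (n + 1) := by
      rw [← zpow_natCast]
      congr 1
      push_cast
      ring
    have hv : toL r ^ (-2 : ℤ) * toL r ^ 2 = 1 := by
      rw [← zpow_natCast, ← zpow_add₀ hρ]
      simp
    have hvn : (toL r ^ (-2 : ℤ)) ^ n * toL r ^ (2 * n) = 1 := by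
      rw [pow_mul, ← mul_pow, hv, one_pow]
    rw [e', map_mul, hC, map_pow, hn, ← pow_mul, h2, pow_add]
    generalize toL r ^ (-2 : ℤ) = v at *
    linear_combination (v * s ^ (n + 1) * toL r ^ e) * hvn
  · have e' : upper (auxCoeff r RatFunc.X) n
        = PowerSeries.C (RatFunc.X ^ (-n : ℤ)) * r ^ (3 * (n * (n + 1) / 2) + 2 * n + 2) := by
      rw [upper, auxCoeff, sgn_succ, sgn_natCast, tri_natCast_succ,
        show (3 * ((n * (n + 1) / 2 : ℕ) : ℤ) + 2 * (n + 1)).toNat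
          = 3 * (n * (n + 1) / 2) + 2 * n + 2 by omega, show (1 - (n + 1) : ℤ) = -n by ring]
      linear_combination PowerSeries.C (RatFunc.X ^ (-n : ℤ))
        * r ^ (3 * (n * (n + 1) / 2) + 2 * n + 2)
        * neg_one_pow_mul_self (A := (RatFunc ℚ)⟦X⟧) n
    have hv : toL r ^ (-2 : ℤ) * toL r ^ 2 = 1 := by
      rw [← zpow_natCast, ← zpow_add₀ hρ]
      simp
    have hvn : (toL r ^ (-2 : ℤ)) ^ (-n : ℤ) = toL r ^ (2 * n) := by
      rw [← zpow_mul, ← zpow_natCast]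
      congr 1
      push_cast
      ring
    rw [e', map_mul, hC, map_pow, mul_zpow, hvn, pow_add, pow_add, pow_mul]
    linear_combination (-((toL r ^ 3) ^ (n * (n + 1) / 2) * s ^ (-n : ℤ) * toL r ^ (2 * n))) * hv

/-! ### The formula in terms of the series `T` -/

theorem incl_pow_of_isNome {q r : PowerSeries ℚ} (h : IsNome q r) :
    incl q = incl r ^ 3 := by rw [← h.2.1, map_pow]

/-- The cube root of the nome, with coefficients in `ℚ(s)`. -/
def extend (r : PowerSeries ℚ) : (RatFunc ℚ)⟦X⟧ := PowerSeries.map (algebraMap ℚ (RatFunc ℚ)) r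

theorem incl_eq_toL (r : PowerSeries ℚ) : incl r = toL (extend r) := rfl

theorem X_dvd_of_isNome {q r : PowerSeries ℚ} (h : IsNome q r) : X ∣ r := by
  have := congrArg constantCoeff h.2.1
  rw [map_pow, h.1] at this
  exact X_dvd_iff.2 (pow_eq_zero_iff (by norm_num) |>.1 this)

theorem X_dvd_extend {r : PowerSeries ℚ} (h : X ∣ r) : X ∣ extend r := by
  have := map_dvd (PowerSeries.map (algebraMap ℚ (RatFunc ℚ))) h
  rwa [map_X] at this

theorem two_ne_zero_L : (2 : L) ≠ 0 := by
  rw [← map_ofNat toL 2, map_ne_zero_iff toL toL_injective]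
  refine ne_zero_of_constantCoeff ?_
  rw [map_ofNat]
  exact two_ne_zero

theorem t_ne_zero : (t : L) ≠ 0 := by
  rw [t, Ne, HahnSeries.single_eq_zero_iff]
  exact one_ne_zero

section Values

variable {r : (RatFunc ℚ)⟦X⟧}

theorem T_theta_zero (hr : X ∣ r) (hr0 : r ≠ 0) {j : ℕ} (hj : j ≤ 2) :
    KrewerasWinding.T 0 ((toL r ^ 3) ^ j) ((toL r ^ 3) ^ 3) = -toL (evalOne (theta r j)) := by
  rw [(represents_theta hr hr0 hj).T_eq, pairSum_zero (decays_thetaCoeff hr hj), one_mul, map_neg,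
    theta]

theorem T_theta_one (hr : X ∣ r) (hr0 : r ≠ 0) {j : ℕ} (hj : j ≤ 2) :
    KrewerasWinding.T 1 ((toL r ^ 3) ^ j) ((toL r ^ 3) ^ 3)
      = toL (evalOne (theta r j) - 2 * derivOne (theta r j)) := by
  rw [(represents_theta hr hr0 hj).T_eq, pairSum_one (decays_thetaCoeff hr hj), one_mul, theta]

theorem T_aux_zero (hr : X ∣ r) (hr0 : r ≠ 0) :
    KrewerasWinding.T 0 (s * toL r ^ (-2 : ℤ)) (toL r ^ 3)
      = toL r ^ (-2 : ℤ) * toL (evalOne (auxTheta r RatFunc.X)) := by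
  have h := represents_aux hr hr0
  rw [h.T_eq, pairSum_zero_swap h, pairSum_zero (decays_auxCoeff hr _), neg_neg, auxTheta]

theorem T_aux_one (hr : X ∣ r) (hr0 : r ≠ 0) :
    KrewerasWinding.T 1 (s * toL r ^ (-2 : ℤ)) (toL r ^ 3)
      = toL r ^ (-2 : ℤ) * toL (evalOne (auxTheta r RatFunc.X)
        - 2 * derivOne (auxTheta r RatFunc.X)) := by
  rw [(represents_aux hr hr0).T_eq, pairSum_one_swap, pairSum_one (decays_auxCoeff hr _), auxTheta]

theorem T_one_one (hr : X ∣ r) (hr0 : r ≠ 0) :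
    KrewerasWinding.T 1 1 ((toL r ^ 3) ^ 3) = -2 * toL (derivOne (theta r 0)) := by
  have h := T_theta_one hr hr0 (Nat.zero_le 2)
  rw [pow_zero, evalOne_theta_zero, zero_sub, map_neg, map_mul, map_ofNat] at h
  rw [h]
  ring

theorem derivOne_theta_zero_ne_zero : toL (derivOne (theta r 0)) ≠ 0 :=
  (map_ne_zero_iff toL toL_injective).2 (ne_zero_of_constantCoeff (by
    rw [constantCoeff_derivOne_theta_zero]; simp))

theorem T_one_one_ne_zero (hr : X ∣ r) (hr0 : r ≠ 0) :
    KrewerasWinding.T 1 1 ((toL r ^ 3) ^ 3) ≠ 0 := by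
  rw [T_one_one hr hr0]
  exact mul_ne_zero (neg_ne_zero.2 two_ne_zero_L) derivOne_theta_zero_ne_zero

theorem evalOne_auxTheta_ne_zero (hr : X ∣ r) : toL (evalOne (auxTheta r RatFunc.X)) ≠ 0 :=
  (map_ne_zero_iff toL toL_injective).2 (ne_zero_of_constantCoeff (by
    rw [constantCoeff_evalOne_auxTheta hr]; exact RatFunc.X_ne_zero))

theorem T_aux_zero_ne_zero (hr : X ∣ r) (hr0 : r ≠ 0) :
    KrewerasWinding.T 0 (s * toL r ^ (-2 : ℤ)) (toL r ^ 3) ≠ 0 := by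
  rw [T_aux_zero hr hr0]
  exact mul_ne_zero (zpow_ne_zero _ ((map_ne_zero_iff toL toL_injective).2 hr0))
    (evalOne_auxTheta_ne_zero hr)

/-- The numerator is −2α'(1), and the denominator is −4β + 6(β − 2β') = −2(6β' − β) at u = 1. It is
nonzero because otherwise the convention x / 0 = 0 would give t = 0. -/
theorem nome_relation (hr : X ∣ r) (hr0 : r ≠ 0) (h : t = toL r * (T 1 1 ((toL r ^ 3) ^ 3) /
      (4 * T 0 (toL r ^ 3) ((toL r ^ 3) ^ 3) + 6 * T 1 (toL r ^ 3) ((toL r ^ 3) ^ 3)))) :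
    X * (6 * derivOne (theta r 1) - evalOne (theta r 1)) = r * derivOne (theta r 0) := by
  have hden : 4 * T 0 (toL r ^ 3) ((toL r ^ 3) ^ 3) + 6 * T 1 (toL r ^ 3) ((toL r ^ 3) ^ 3) ≠ 0 := by
    intro h0
    rw [h0, div_zero, mul_zero] at h
    exact t_ne_zero h
  have h0 := T_theta_zero hr hr0 (show 1 ≤ 2 by norm_num)
  have h1 := T_theta_one hr hr0 (show 1 ≤ 2 by norm_num)
  rw [pow_one] at h0 h1
  rw [← mul_div_assoc, eq_div_iff hden, h0, h1, T_one_one hr hr0] at h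
  refine toL_injective ?_
  simp only [map_mul, map_sub, map_ofNat, toL_X] at h ⊢
  refine mul_left_cancel₀ (neg_ne_zero.2 two_ne_zero_L) ?_
  linear_combination h

/-- The generating function of the walks ending at the origin, in terms of the series `T`. -/
theorem originSeries_eq (hr : X ∣ r) (hr0 : r ≠ 0) (h : t = toL r * (T 1 1 ((toL r ^ 3) ^ 3) /
      (4 * T 0 (toL r ^ 3) ((toL r ^ 3) ^ 3) + 6 * T 1 (toL r ^ 3) ((toL r ^ 3) ^ 3)))) :
    toL (originSeries RatFunc.X) = s / ((1 - s ^ 3) * t) *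
      (s - (toL r)⁻¹ * (T 1 ((toL r ^ 3) ^ 2) ((toL r ^ 3) ^ 3) / T 1 1 ((toL r ^ 3) ^ 3))
        - (toL r)⁻¹ * ((T 0 (toL r ^ 3) ((toL r ^ 3) ^ 3) *
            T 1 (s * toL r ^ (-2 : ℤ)) (toL r ^ 3)) /
          (T 1 1 ((toL r ^ 3) ^ 3) * T 0 (s * toL r ^ (-2 : ℤ)) (toL r ^ 3)))) := by
  have hmain := congrArg toL (originSeries_theta hr hr0 RatFunc.X_ne_zero (nome_relation hr hr0 h))
  have h0 := T_theta_zero hr hr0 (show 1 ≤ 2 by norm_num)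
  rw [pow_one] at h0
  rw [T_theta_one hr hr0 le_rfl, h0, T_one_one hr hr0, T_aux_one hr hr0, T_aux_zero hr hr0,
    evalOne_theta_two hr, derivOne_theta_two hr]
  have hρ : toL r ≠ 0 := (map_ne_zero_iff toL toL_injective).2 hr0
  have hα := derivOne_theta_zero_ne_zero (r := r)
  have hH := evalOne_auxTheta_ne_zero hr
  have hs : toL (PowerSeries.C RatFunc.X) = s := toL_C _
  have ht := t_ne_zero
  have h2 := two_ne_zero_L
  have hs3 : (1 - s ^ 3 : L) ≠ 0 := by
    have : (1 - s ^ 3 : L) = HahnSeries.C (1 - RatFunc.X ^ 3) := by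
      rw [map_sub, map_pow, map_one]; rfl
    rw [this, map_ne_zero_iff _ HahnSeries.C_injective]
    intro h0
    have h1 : (1 - Polynomial.X ^ 3 : Polynomial ℚ) = 0 := by
      refine RatFunc.algebraMap_injective ℚ ?_
      rw [map_sub, map_pow, RatFunc.algebraMap_X, map_one, map_zero, h0]
    have := congrArg (Polynomial.eval 2) h1
    norm_num at this
  simp only [map_mul, map_sub, map_add, map_neg, map_pow, map_one, map_ofNat, toL_X, hs] at hmain ⊢
  have hv : toL r ^ (-2 : ℤ) ≠ 0 := zpow_ne_zero _ hρ
  generalize toL r ^ (-2 : ℤ) = v at *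
  field_simp
  linear_combination 2 * hmain

end Values

end

end WindingSeries

/-! ### The nome: existence, uniqueness and expansion. -/

namespace WindingSeries

open PowerSeries KrewerasWinding

noncomputable section

/-! ### Existence and uniqueness of the nome -/

/-- The contraction principle for the X-adic metric, with iteration started at 0. -/
theorem existsUnique_fixedPoint {A : Type*} [CommRing A] (Φ : A⟦X⟧ → A⟦X⟧)
    (hΦ : ∀ (f g : A⟦X⟧) (n : ℕ), X ^ n ∣ f - g → X ^ (n + 1) ∣ Φ f - Φ g) : ∃! f, Φ f = f := by
  set F : ℕ → A⟦X⟧ := fun n => Φ^[n] 0 with hF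
  have hsucc : ∀ n, F (n + 1) = Φ (F n) := fun n => Function.iterate_succ_apply' Φ n 0
  have hstep : ∀ n, X ^ n ∣ F (n + 1) - F n := by
    intro n
    induction n with
    | zero => rw [pow_zero]; exact one_dvd _
    | succ n ih =>
      have := hΦ _ _ _ ih
      rwa [← hsucc, ← hsucc] at this
  have hlim : ∀ N, X ^ N ∣ formalSum (fun n => F (n + 1) - F n) - F N := by
    intro N
    have := formalSum_sub_dvd hstep N
    rw [Finset.sum_range_sub] at this
    simpa [hF] using this
  refine ⟨formalSum fun n => F (n + 1) - F n, eq_of_forall_X_pow_dvd_sub fun N => ?_, ?_⟩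
  · have h1 := (pow_dvd_pow X (Nat.le_succ N)).trans (hΦ _ _ _ (hlim N))
    have h2 := (pow_dvd_pow X (Nat.le_succ N)).trans (hlim (N + 1))
    rw [hsucc] at h2
    have := dvd_sub h1 h2
    rwa [sub_sub_sub_cancel_right] at this
  · intro g hg
    refine eq_of_forall_X_pow_dvd_sub fun N => ?_
    generalize formalSum (fun n => F (n + 1) - F n) = f at *
    have hgF : ∀ N, X ^ N ∣ g - F N := by
      intro N
      induction N with
      | zero => rw [pow_zero]; exact one_dvd _
      | succ N ih =>
        have := hΦ _ _ _ ih
        rwa [hg, ← hsucc] at this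
    have := dvd_sub (hgF N) (hlim N)
    rwa [sub_sub_sub_cancel_right] at this

theorem X_pow_dvd_formalSum {A : Type*} [CommRing A] {f : ℕ → A⟦X⟧} {N : ℕ}
    (h : ∀ n, X ^ N ∣ f n) : X ^ N ∣ formalSum f := by
  rw [X_pow_dvd_iff]
  intro m hm
  rw [formalSum, coeff_mk]
  exact Finset.sum_eq_zero fun n _ => X_pow_dvd_iff.1 (h n) m hm

theorem formalSum_sub_dvd_of_tail {A : Type*} [CommRing A] {f : ℕ → A⟦X⟧}
    (hf : ∀ n, X ^ n ∣ f n) {M N : ℕ} (h : ∀ n, M ≤ n → X ^ N ∣ f n) :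
    X ^ N ∣ formalSum f - ∑ n ∈ Finset.range M, f n := by
  have h1 := (pow_dvd_pow X (Nat.le_add_left N M)).trans (formalSum_sub_dvd hf (M + N))
  rw [Finset.sum_range_add, ← sub_sub] at h1
  have h2 : X ^ N ∣ ∑ n ∈ Finset.range N, f (M + n) :=
    Finset.dvd_sum fun n _ => h _ (Nat.le_add_right _ _)
  have := dvd_add h1 h2
  rwa [sub_add_cancel] at this

section Theta

variable {K : Type*} [Field K]

theorem X_pow_dvd_thetaCoeff_sub {r r' : K⟦X⟧} {N : ℕ} (h : X ^ N ∣ r - r') (j : ℕ) (n : ℤ) :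
    X ^ N ∣ thetaCoeff r j n - thetaCoeff r' j n := by
  rw [thetaCoeff, thetaCoeff, ← mul_sub]
  exact (h.trans (sub_dvd_pow_sub_pow _ _ _)).mul_left _

theorem X_pow_dvd_evalOne_theta_sub {r r' : K⟦X⟧} {N : ℕ} (h : X ^ N ∣ r - r') (j : ℕ) :
    X ^ N ∣ evalOne (theta r j) - evalOne (theta r' j) := by
  rw [theta, theta, evalOne_bilateral, evalOne_bilateral, ← formalSum_sub]
  refine X_pow_dvd_formalSum fun n => ?_
  rw [add_sub_add_comm]
  exact dvd_add (X_pow_dvd_thetaCoeff_sub h _ _) (X_pow_dvd_thetaCoeff_sub h _ _)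

theorem X_pow_dvd_derivOne_theta_sub {r r' : K⟦X⟧} {N : ℕ} (h : X ^ N ∣ r - r') (j : ℕ) :
    X ^ N ∣ derivOne (theta r j) - derivOne (theta r' j) := by
  rw [theta, theta, derivOne_bilateral, derivOne_bilateral, ← formalSum_sub]
  refine X_pow_dvd_formalSum fun n => ?_
  rw [add_sub_add_comm, ← mul_sub, ← mul_sub]
  exact dvd_add ((X_pow_dvd_thetaCoeff_sub h _ _).mul_left _)
    ((X_pow_dvd_thetaCoeff_sub h _ _).mul_left _)

/-- The relation between the variable and the cube root of the nome. -/
def NomeRelation (r : K⟦X⟧) : Prop :=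
  X * (6 * derivOne (theta r 1) - evalOne (theta r 1)) = r * derivOne (theta r 0)

/-- As α'(1) has constant term −1 it can be divided by, and with r = Xρ the relation becomes ρ =
D(ρ)/E(ρ). The right side depends on ρ only through Xρ, so it contracts. -/
theorem existsUnique_nomeRelation : ∃! ρ : K⟦X⟧, NomeRelation (X * ρ) := by
  set D : K⟦X⟧ → K⟦X⟧ := fun ρ => 6 * derivOne (theta (X * ρ) 1) - evalOne (theta (X * ρ) 1)
    with hD
  set E : K⟦X⟧ → K⟦X⟧ := fun ρ => derivOne (theta (X * ρ) 0) with hE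
  have hinv : ∀ ρ, E ρ * (E ρ)⁻¹ = 1 := fun ρ => PowerSeries.mul_inv_cancel _ (by
    rw [hE, constantCoeff_derivOne_theta_zero]; simp)
  have hiff : ∀ ρ : K⟦X⟧, NomeRelation (X * ρ) ↔ D ρ * (E ρ)⁻¹ = ρ := by
    intro ρ
    rw [NomeRelation, mul_assoc, mul_right_inj' X_ne_zero]
    change D ρ = ρ * E ρ ↔ _
    constructor
    · intro h
      rw [h, mul_assoc, hinv, mul_one]
    · intro h
      linear_combination E ρ * h - D ρ * hinv ρ
  simp only [hiff]
  refine existsUnique_fixedPoint (fun ρ => D ρ * (E ρ)⁻¹) fun f g n hfg => ?_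
  have h : X ^ (n + 1) ∣ X * f - X * g := by
    rw [← mul_sub, pow_succ']
    exact mul_dvd_mul_left X hfg
  have hDd : X ^ (n + 1) ∣ D f - D g := by
    have := dvd_sub ((X_pow_dvd_derivOne_theta_sub h 1).mul_left 6)
      (X_pow_dvd_evalOne_theta_sub h 1)
    convert this using 1
    simp only [hD]
    ring
  have hEd : X ^ (n + 1) ∣ E f - E g := X_pow_dvd_derivOne_theta_sub h 0
  have e : D f * (E f)⁻¹ - D g * (E g)⁻¹
      = (D f - D g) * (E f)⁻¹ - (E f - E g) * (D g * (E f)⁻¹ * (E g)⁻¹) := by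
    linear_combination (D g * (E g)⁻¹) * hinv f - (D g * (E f)⁻¹) * hinv g
  rw [e]
  exact dvd_sub (hDd.mul_right _) (hEd.mul_right _)

/-! ### The expansion of the nome -/

theorem X_pow_nine_dvd_thetaCoeff {r : K⟦X⟧} (hr : X ∣ r) {j : ℕ} (hj : j ≤ 1) {n : ℕ}
    (hn : 2 ≤ n) : X ^ 9 ∣ thetaCoeff r j (-n) ∧ X ^ 9 ∣ thetaCoeff r j (n + 1) := by
  obtain ⟨h1, h2⟩ := natCast_le_tri_add n
  have hj' : (j : ℤ) = 0 ∨ (j : ℤ) = 1 := by omega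
  refine ⟨(X_pow_dvd_pow hr ?_).mul_left _, (X_pow_dvd_pow hr ?_).mul_left _⟩
  · rw [tri_neg]
    rcases hj' with h' | h' <;> rw [h'] <;> omega
  · rw [tri_succ]
    rcases hj' with h' | h' <;> rw [h'] <;> omega

theorem X_pow_nine_dvd_evalOne_theta {r : K⟦X⟧} (hr : X ∣ r) {j : ℕ} (hj : j ≤ 1) :
    X ^ 9 ∣ evalOne (theta r j) - (thetaCoeff r j 0 + thetaCoeff r j 1
      + (thetaCoeff r j (-1) + thetaCoeff r j 2)) := by
  have hd := decays_thetaCoeff hr (show j ≤ 2 by omega)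
  rw [theta, evalOne_bilateral]
  have := formalSum_sub_dvd_of_tail (M := 2) (N := 9)
    (f := fun m : ℕ => thetaCoeff r j (-m) + thetaCoeff r j (m + 1))
    (fun n => dvd_add (hd n).1 (hd n).2)
    fun n hn => dvd_add (X_pow_nine_dvd_thetaCoeff hr hj hn).1 (X_pow_nine_dvd_thetaCoeff hr hj hn).2
  simpa [Finset.sum_range_succ] using this

theorem X_pow_nine_dvd_derivOne_theta {r : K⟦X⟧} (hr : X ∣ r) {j : ℕ} (hj : j ≤ 1) :
    X ^ 9 ∣ derivOne (theta r j) - (thetaCoeff r j 1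
      + (-thetaCoeff r j (-1) + 2 * thetaCoeff r j 2)) := by
  have hd := decays_thetaCoeff hr (show j ≤ 2 by omega)
  rw [theta, derivOne_bilateral]
  have := formalSum_sub_dvd_of_tail (M := 2) (N := 9)
    (f := fun m : ℕ => -(m : K⟦X⟧) * thetaCoeff r j (-m)
      + ((m : K⟦X⟧) + 1) * thetaCoeff r j (m + 1))
    (fun n => dvd_add ((hd n).1.mul_left _) ((hd n).2.mul_left _))
    fun n hn => dvd_add ((X_pow_nine_dvd_thetaCoeff hr hj hn).1.mul_left _)
      ((X_pow_nine_dvd_thetaCoeff hr hj hn).2.mul_left _)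
  simpa [Finset.sum_range_succ, one_add_one_eq_two] using this

theorem NomeRelation.expansion {r : K⟦X⟧} (hr : X ∣ r) (h : NomeRelation r) :
    X ^ 12 ∣ r ^ 3 - (X ^ 3 + 15 * X ^ 6 + 279 * X ^ 9) := by
  have c0 : thetaCoeff r 0 (-1) = -r ^ 9 ∧ thetaCoeff r 0 2 = r ^ 9 := by
    constructor <;> norm_num [thetaCoeff, sgn, tri] <;> rfl
  have c1 : thetaCoeff r 1 (-1) = -r ^ 6 ∧ thetaCoeff r 1 2 = r ^ 15 := by
    constructor <;> norm_num [thetaCoeff, sgn, tri] <;> rfl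
  obtain ⟨a, ha⟩ := X_pow_nine_dvd_evalOne_theta hr (j := 1) le_rfl
  obtain ⟨b, hb⟩ := X_pow_nine_dvd_derivOne_theta hr (j := 1) le_rfl
  obtain ⟨c, hc⟩ := X_pow_nine_dvd_derivOne_theta hr (j := 0) zero_le_one
  rw [c1.1, c1.2, thetaCoeff_one, thetaCoeff_zero] at ha
  rw [c1.1, c1.2, thetaCoeff_one] at hb
  rw [c0.1, c0.2, thetaCoeff_one] at hc
  rw [NomeRelation] at h
  obtain ⟨ρ, rfl⟩ := hr
  -- Up to O(X⁹), β = 1 − r³ − r⁶ + r¹⁵, β' = −r³ + r⁶ + 2r¹⁵ and α' = −1 + 3r⁹ at u = 1. Iterating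
  -- the resulting equation gains three orders each time: r = X + 5X⁴ + 68X⁷ + O(X¹⁰).
  obtain ⟨g, hg⟩ : ∃ g, X * ρ = X * (1 + 5 * (X * ρ) ^ 3 - 7 * (X * ρ) ^ 6) + X ^ 10 * g := by
    refine ⟨-11 * X ^ 6 * ρ ^ 15 - 6 * b + a + 3 * ρ ^ 10 + ρ * c, ?_⟩
    linear_combination h - 6 * X * hb + X * ha + X * ρ * hc
  obtain ⟨g₁, hg₁⟩ : ∃ g₁, X * ρ = X + X ^ 4 * g₁ := by
    refine ⟨5 * ρ ^ 3 - 7 * X ^ 3 * ρ ^ 6 + X ^ 6 * g, ?_⟩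
    linear_combination hg
  obtain ⟨g₂, hg₂⟩ : ∃ g₂, X * ρ = X + 5 * X ^ 4 + X ^ 7 * g₂ := by
    refine ⟨5 * (3 * g₁ + 3 * X ^ 3 * g₁ ^ 2 + X ^ 6 * g₁ ^ 3) - 7 * ρ ^ 6 + X ^ 3 * g, ?_⟩
    have h3 := congrArg (fun z => z ^ 3) hg₁
    linear_combination hg + 5 * X * h3
  obtain ⟨g₃, hg₃⟩ : ∃ g₃, X * ρ = X + 5 * X ^ 4 + 68 * X ^ 7 + X ^ 10 * g₃ := by
    refine ⟨5 * (3 * g₂ + 3 * (5 + X ^ 3 * g₂) ^ 2 + X ^ 3 * (5 + X ^ 3 * g₂) ^ 3)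
      - 7 * g₁ * (6 + 15 * (X ^ 3 * g₁) + 20 * (X ^ 3 * g₁) ^ 2 + 15 * (X ^ 3 * g₁) ^ 3
        + 6 * (X ^ 3 * g₁) ^ 4 + (X ^ 3 * g₁) ^ 5) + g, ?_⟩
    have h3 := congrArg (fun z => z ^ 3) hg₂
    have h6 := congrArg (fun z => z ^ 6) hg₁
    linear_combination hg + 5 * X * h3 - 7 * X * h6
  refine ⟨3 * g₃ + 3 * (680 + 10 * X ^ 3 * g₃ + X ^ 3 * (68 + X ^ 3 * g₃) ^ 2)
    + (5 + 68 * X ^ 3 + X ^ 6 * g₃) ^ 3, ?_⟩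
  rw [hg₃]
  ring

end Theta

theorem extend_injective : Function.Injective extend :=
  PowerSeries.map_injective _ (algebraMap ℚ (RatFunc ℚ)).injective

theorem extend_thetaCoeff (r : PowerSeries ℚ) (j : ℕ) (n : ℤ) :
    extend (thetaCoeff r j n) = thetaCoeff (extend r) j n := by
  simp [extend, thetaCoeff, sgn]

theorem extend_evalOne_theta (r : PowerSeries ℚ) (j : ℕ) :
    extend (evalOne (theta r j)) = evalOne (theta (extend r) j) := by
  rw [theta, theta, evalOne_bilateral, evalOne_bilateral, extend, map_formalSum]
  congr 1
  ext1 n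
  rw [map_add, ← extend_thetaCoeff, ← extend_thetaCoeff]
  rfl

theorem extend_derivOne_theta (r : PowerSeries ℚ) (j : ℕ) :
    extend (derivOne (theta r j)) = derivOne (theta (extend r) j) := by
  rw [theta, theta, derivOne_bilateral, derivOne_bilateral, extend, map_formalSum]
  congr 1
  ext1 n
  rw [← extend_thetaCoeff, ← extend_thetaCoeff]
  simp [extend]

/-- The relation has integer coefficients, so it can be solved over ℚ and used over ℚ(s). -/
theorem nomeRelation_extend_iff {r : PowerSeries ℚ} : NomeRelation (extend r) ↔ NomeRelation r := by
  rw [NomeRelation, NomeRelation, ← extend_injective.eq_iff, ← extend_derivOne_theta,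
    ← extend_derivOne_theta, ← extend_evalOne_theta]
  have h6 : PowerSeries.map (algebraMap ℚ (RatFunc ℚ)) 6 = 6 := map_ofNat _ 6
  simp [extend, h6]

theorem extend_ne_zero_of_isNome {q r : PowerSeries ℚ} (h : IsNome q r) : extend r ≠ 0 := by
  intro h0
  have := h.2.2
  rw [incl_eq_toL, h0, map_zero, zero_mul] at this
  exact t_ne_zero this

theorem relation_of_isNome {q r : PowerSeries ℚ} (h : IsNome q r) :
    t = toL (extend r) * (T 1 1 ((toL (extend r) ^ 3) ^ 3) /
      (4 * T 0 (toL (extend r) ^ 3) ((toL (extend r) ^ 3) ^ 3)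
        + 6 * T 1 (toL (extend r) ^ 3) ((toL (extend r) ^ 3) ^ 3))) := by
  have := h.2.2
  rwa [incl_pow_of_isNome h, incl_eq_toL] at this

theorem nomeRelation_of_isNome {q r : PowerSeries ℚ} (h : IsNome q r) : NomeRelation r :=
  nomeRelation_extend_iff.1 (nome_relation (X_dvd_extend (X_dvd_of_isNome h))
    (extend_ne_zero_of_isNome h) (relation_of_isNome h))

theorem isNome_of_nomeRelation {r : PowerSeries ℚ} (hr : X ∣ r) (h : NomeRelation r) :
    IsNome (r ^ 3) r := by
  have hr' := X_dvd_extend hr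
  have h' := nomeRelation_extend_iff.2 h
  rw [NomeRelation] at h'
  -- Its constant term is −1.
  have hden : 6 * derivOne (theta (extend r) 1) - evalOne (theta (extend r) 1) ≠ 0 := by
    intro h0
    have hc := constantCoeff_evalOne_theta_one hr'
    have hd : constantCoeff (derivOne (theta (extend r) 1)) = 0 := by
      rw [theta, derivOne_bilateral, constantCoeff_formalSum]
      simp [thetaCoeff_one, X_dvd_iff.1 hr']
    have := congrArg constantCoeff h0
    rw [map_sub, map_mul, hc, hd] at this
    simp at this
  have hr0 : extend r ≠ 0 := by
    intro h0
    rw [h0] at h' hden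
    rw [zero_mul] at h'
    exact (mul_ne_zero X_ne_zero hden) h'
  refine ⟨by rw [map_pow, X_dvd_iff.1 hr, zero_pow (by norm_num)], rfl, ?_⟩
  have h0 := T_theta_zero hr' hr0 (show 1 ≤ 2 by norm_num)
  have h1 := T_theta_one hr' hr0 (show 1 ≤ 2 by norm_num)
  rw [pow_one] at h0 h1
  rw [map_pow, incl_eq_toL, h0, h1, T_one_one hr' hr0, ← mul_div_assoc, eq_div_iff]
  · have := congrArg toL h'
    simp only [map_mul, map_sub, map_ofNat, toL_X] at this ⊢
    linear_combination (-2) * this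
  · have hden' := (map_ne_zero_iff toL toL_injective).2 hden
    simp only [map_mul, map_sub, map_ofNat] at hden' ⊢
    intro h2
    refine hden' (mul_left_cancel₀ two_ne_zero_L ?_)
    linear_combination -h2

theorem existsUnique_nome : ∃! q : PowerSeries ℚ, ∃ r : PowerSeries ℚ, IsNome q r := by
  obtain ⟨ρ, hρ, huniq⟩ := existsUnique_nomeRelation (K := ℚ)
  refine ⟨(X * ρ) ^ 3, ⟨_, isNome_of_nomeRelation (dvd_mul_right _ _) hρ⟩, ?_⟩
  rintro q ⟨r, h⟩
  obtain ⟨σ, rfl⟩ := X_dvd_of_isNome h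
  rw [← h.2.1, huniq σ (nomeRelation_of_isNome h)]

theorem expansion_of_isNome {q r : PowerSeries ℚ} (h : IsNome q r) :
    X ^ 12 ∣ q - (X ^ 3 + 15 * X ^ 6 + 279 * X ^ 9) := by
  rw [← h.2.1]
  exact (nomeRelation_of_isNome h).expansion (X_dvd_of_isNome h)

end

end WindingSeries

/-! ### Lattice geometry, winding angles and the count of excursions. -/

namespace WindingSeries

open KrewerasWinding

noncomputable section

/-! ### Geometry of the lattice -/

theorem omega_eq : ω = Complex.exp ((2 * Real.pi / 3 : ℝ) * Complex.I) := by
  rw [ω]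
  push_cast
  rfl

theorem omega_re : ω.re = -1 / 2 := by
  rw [omega_eq, Complex.exp_ofReal_mul_I_re, show 2 * Real.pi / 3 = Real.pi - Real.pi / 3 by ring,
    Real.cos_pi_sub, Real.cos_pi_div_three]
  norm_num

theorem omega_im_pos : 0 < ω.im := by
  rw [omega_eq, Complex.exp_ofReal_mul_I_im]
  exact Real.sin_pos_of_pos_of_lt_pi (by positivity) (by linarith [Real.pi_pos])

theorem omega_im_sq : ω.im ^ 2 = 3 / 4 := by
  rw [omega_eq, Complex.exp_ofReal_mul_I_im, Real.sin_sq,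
    show 2 * Real.pi / 3 = Real.pi - Real.pi / 3 by ring, Real.cos_pi_sub, Real.cos_pi_div_three]
  norm_num

theorem omega_sq : ω ^ 2 = -1 - ω := by
  have h := omega_im_sq
  rw [pow_two] at h ⊢
  apply Complex.ext
  · rw [Complex.mul_re, omega_re, h, Complex.sub_re, omega_re]
    norm_num
  · rw [Complex.mul_im, omega_re, Complex.sub_im]
    norm_num
    ring

theorem omega_ne_zero : ω ≠ 0 := Complex.exp_ne_zero _

theorem omega_cube : ω ^ 3 = 1 := by
  linear_combination (ω - 1) * omega_sq

theorem norm_omega : ‖ω‖ = 1 := by rw [omega_eq, Complex.norm_exp_ofReal_mul_I]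

theorem omega_zpow (k : ℤ) : ω ^ k = 1 ∨ ω ^ k = ω ∨ ω ^ k = ω ^ 2 := by
  have h : ω ^ k = ω ^ (k % 3) := by
    conv_lhs => rw [← Int.mul_ediv_add_emod k 3]
    rw [zpow_add₀ omega_ne_zero, zpow_mul]
    rw [show ω ^ (3 : ℤ) = ω ^ 3 from rfl, omega_cube, one_zpow, one_mul]
  have : k % 3 = 0 ∨ k % 3 = 1 ∨ k % 3 = 2 := by omega
  rcases this with h' | h' | h' <;> rw [h, h']
  · simp
  · simp
  · exact Or.inr (Or.inr rfl)

theorem normSq_add_mul_omega (x y : ℝ) :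
    Complex.normSq (x + y * ω) = x ^ 2 - x * y + y ^ 2 := by
  have h := omega_im_sq
  rw [Complex.normSq_apply]
  simp only [Complex.add_re, Complex.add_im, Complex.ofReal_re, Complex.ofReal_im,
    Complex.re_ofReal_mul, Complex.im_ofReal_mul, omega_re]
  linear_combination y ^ 2 * h

theorem omega_mul_mem {z : ℂ} (hz : z ∈ vertices) : ω * z ∈ vertices := by
  obtain ⟨a, b, rfl⟩ := hz
  refine ⟨1 - b, a - b, ?_⟩
  push_cast
  linear_combination (b - 1 / 3) * omega_sq

theorem omega_zpow_mul_mem {z : ℂ} (hz : z ∈ vertices) (k : ℤ) : ω ^ k * z ∈ vertices := by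
  rcases omega_zpow k with h | h | h <;> rw [h]
  · rwa [one_mul]
  · exact omega_mul_mem hz
  · rw [pow_two, mul_assoc]
    exact omega_mul_mem (omega_mul_mem hz)

/-- The points of the quadrant, up to sign. -/
def quad (i j : ℕ) : ℂ := (2 / 3 + i : ℝ) + (1 / 3 + j : ℝ) * ω

/-- The position of a state, where `m` is the number of the initial quadrant. -/
def pos (m : ℤ) (σ : ℤ × ℕ × ℕ) : ℂ := -(ω ^ (m + σ.1) * quad σ.2.1 σ.2.2)

theorem quad_im_pos (i j : ℕ) : 0 < (quad i j).im := by
  rw [quad, Complex.add_im, Complex.ofReal_im, Complex.im_ofReal_mul, zero_add]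
  have := omega_im_pos
  positivity

theorem quad_ne_zero (i j : ℕ) : quad i j ≠ 0 := by
  intro h
  have := quad_im_pos i j
  rw [h, Complex.zero_im] at this
  exact lt_irrefl _ this

theorem pos_ne_zero (m : ℤ) (σ : ℤ × ℕ × ℕ) : pos m σ ≠ 0 :=
  neg_ne_zero.2 (mul_ne_zero (zpow_ne_zero _ omega_ne_zero) (quad_ne_zero _ _))

theorem pos_mem (m : ℤ) (σ : ℤ × ℕ × ℕ) : pos m σ ∈ vertices := by
  rw [pos, ← mul_neg]
  refine omega_zpow_mul_mem ⟨-σ.2.1, -σ.2.2, ?_⟩ _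
  rw [quad]
  push_cast
  ring

/-- The letters are directions relative to the current sector. When a step leaves the sector, 1 + ω
+ ω² = 0 matches the coordinates in the old and new sectors. -/
theorem pos_move (m : ℤ) (σ : ℤ × ℕ × ℕ) (a : Fin 3) :
    pos m (move σ a) - pos m σ = ω ^ (m + σ.1) * ω ^ (a : ℕ) := by
  obtain ⟨k, i, j⟩ := σ
  have h1 : ω ^ (m + (k + 1)) = ω ^ (m + k) * ω := by
    rw [← add_assoc, zpow_add₀ omega_ne_zero, zpow_one]
  have h2 : ω ^ (m + (k - 1)) * ω = ω ^ (m + k) := by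
    rw [← zpow_add_one₀ omega_ne_zero]
    congr 1
    ring
  have h3 := omega_sq
  fin_cases a
  · rcases i with _ | i
    · simp only [move, pos, quad, h1]
      push_cast
      linear_combination (-(ω ^ (m + k)) / 3) * h3
    · simp only [move, pos, quad]
      push_cast
      ring
  · rcases j with _ | j
    · simp only [move, pos, quad]
      push_cast
      rw [← h2]
      linear_combination (-(2 / 3 : ℂ) * ω ^ (m + (k - 1))) * h3
    · simp only [move, pos, quad]
      push_cast
      ring
  · simp only [move, pos, quad]
    push_cast
    linear_combination (-(ω ^ (m + k))) * h3

theorem isPrimitiveRoot_omega : IsPrimitiveRoot ω 3 := by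
  have := Complex.isPrimitiveRoot_exp 3 (by norm_num)
  convert this using 1
  rw [ω]
  congr 1
  push_cast
  ring

theorem move_injective {m : ℤ} {σ : ℤ × ℕ × ℕ} {a b : Fin 3}
    (h : pos m (move σ a) = pos m (move σ b)) : a = b := by
  have ha := pos_move m σ a
  rw [h, pos_move m σ b] at ha
  have hω := mul_left_cancel₀ (zpow_ne_zero _ omega_ne_zero) ha
  exact Fin.ext (isPrimitiveRoot_omega.pow_inj b.2 a.2 hω).symm

theorem isEdge_move (m : ℤ) (σ : ℤ × ℕ × ℕ) (a : Fin 3) :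
    IsEdge (pos m σ) (pos m (move σ a)) := by
  refine ⟨pos_mem _ _, pos_mem _ _, ?_⟩
  rw [pos_move, ← zpow_natCast, ← zpow_add₀ omega_ne_zero]
  exact omega_zpow _

theorem exists_move {m : ℤ} {σ : ℤ × ℕ × ℕ} {w : ℂ} (h : IsEdge (pos m σ) w) :
    ∃ a, pos m (move σ a) = w := by
  obtain ⟨d, hd⟩ : ∃ d : ℤ, w - pos m σ = ω ^ d := by
    rcases h.2.2 with h | h | h
    · exact ⟨0, by simpa using h⟩
    · exact ⟨1, by simpa using h⟩
    · exact ⟨2, h⟩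
  have hz : ∀ a : Fin 3, ω ^ (d - (m + σ.1)) = ω ^ (a : ℕ) → ∃ a, pos m (move σ a) = w := by
    intro a ha
    refine ⟨a, ?_⟩
    have := pos_move m σ a
    rw [← ha, ← zpow_add₀ omega_ne_zero, add_sub_cancel, ← hd] at this
    linear_combination this
  rcases omega_zpow (d - (m + σ.1)) with h | h | h
  · exact hz 0 (by simpa using h)
  · exact hz 1 (by simpa using h)
  · exact hz 2 (by simpa using h)

/-! ### The vertices closest to the origin -/

theorem normSq_pos (m : ℤ) (σ : ℤ × ℕ × ℕ) :
    Complex.normSq (pos m σ) = 1 / 3 + ((σ.2.1 : ℝ) ^ 2 - σ.2.1 * σ.2.2 + (σ.2.2 : ℝ) ^ 2 + σ.2.1) := by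
  rw [pos, Complex.normSq_neg, map_mul, quad, normSq_add_mul_omega, Complex.normSq_eq_norm_sq,
    norm_zpow, norm_omega, one_zpow]
  ring

theorem normSq_vertex (a b : ℤ) : Complex.normSq (-(2 + ω) / 3 + a + b * ω)
    = 1 / 3 + ((a ^ 2 - a * b + b ^ 2 - a : ℤ) : ℝ) := by
  have : -(2 + ω) / 3 + a + b * ω = ((a - 2 / 3 : ℝ) : ℂ) + ((b - 1 / 3 : ℝ) : ℂ) * ω := by
    push_cast
    ring
  rw [this, normSq_add_mul_omega]
  push_cast
  ring

theorem quadratic_nonneg (a b : ℤ) : 0 ≤ a ^ 2 - a * b + b ^ 2 - a := by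
  rcases le_or_gt a 0 with h | h
  · nlinarith [sq_nonneg (2 * b - a)]
  · rcases eq_or_lt_of_le (show 1 ≤ a from h) with h1 | h1
    · rw [← h1]
      rcases le_or_gt b 0 with h | h <;> nlinarith
    · nlinarith [sq_nonneg (2 * b - a)]

theorem norm_le_iff_normSq_le (z w : ℂ) : ‖z‖ ≤ ‖w‖ ↔ Complex.normSq z ≤ Complex.normSq w := by
  rw [Complex.normSq_eq_norm_sq, Complex.normSq_eq_norm_sq,
    sq_le_sq₀ (norm_nonneg _) (norm_nonneg _)]

theorem isClosest_iff {v : ℂ} : IsClosest v ↔ v ∈ vertices ∧ Complex.normSq v ≤ 1 / 3 := by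
  constructor
  · rintro ⟨hv, h⟩
    refine ⟨hv, ?_⟩
    have := (norm_le_iff_normSq_le _ _).1 (h _ (pos_mem 0 (0, 0, 0)))
    rw [normSq_pos] at this
    simpa using this
  · rintro ⟨hv, h⟩
    refine ⟨hv, ?_⟩
    rintro _ ⟨a, b, rfl⟩
    rw [norm_le_iff_normSq_le, normSq_vertex]
    have : (0 : ℝ) ≤ ((a ^ 2 - a * b + b ^ 2 - a : ℤ) : ℝ) := by
      exact_mod_cast quadratic_nonneg a b
    linarith

/-- The squared distance is 1/3 plus the form i² − ij + j² + i, which vanishes on ℕ² only at the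
origin. -/
theorem isClosest_pos_iff {m : ℤ} {σ : ℤ × ℕ × ℕ} : IsClosest (pos m σ) ↔ σ.2 = (0, 0) := by
  rw [isClosest_iff, normSq_pos, and_iff_right (pos_mem m σ)]
  obtain ⟨k, i, j⟩ := σ
  simp only [Prod.mk.injEq]
  constructor
  · intro h
    have h1 : ((i : ℤ) ^ 2 - i * j + (j : ℤ) ^ 2 + i) ≤ 0 := by
      have : ((i : ℝ) ^ 2 - i * j + (j : ℝ) ^ 2 + i) ≤ 0 := by linarith
      exact_mod_cast this
    have hi : (i : ℤ) ≤ 0 := by nlinarith [sq_nonneg ((i : ℤ) - 2 * j), sq_nonneg (i : ℤ)]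
    have hi' : i = 0 := by omega
    subst hi'
    have hj : (j : ℤ) ^ 2 = 0 := by push_cast at h1; nlinarith [sq_nonneg (j : ℤ)]
    exact ⟨rfl, by simpa using hj⟩
  · rintro ⟨rfl, rfl⟩
    simp

theorem exists_pos_of_isClosest {w₀ : ℂ} (h : IsClosest w₀) : ∃ m, w₀ = pos m (0, 0, 0) := by
  obtain ⟨⟨a, b, rfl⟩, h⟩ := isClosest_iff.1 h
  rw [normSq_vertex] at h
  have h0 : a ^ 2 - a * b + b ^ 2 - a ≤ 0 := by
    have : ((a ^ 2 - a * b + b ^ 2 - a : ℤ) : ℝ) ≤ 0 := by linarith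
    exact_mod_cast this
  have ha : 0 ≤ a := by nlinarith [sq_nonneg (2 * b - a)]
  have ha' : a ≤ 1 := by nlinarith [sq_nonneg (2 * b - a)]
  have hs := omega_sq
  obtain rfl | rfl : a = 0 ∨ a = 1 := by omega
  · have : b = 0 := by nlinarith
    subst this
    refine ⟨0, ?_⟩
    simp [pos, quad]
    ring
  · have hb : 0 ≤ b := by nlinarith
    have hb' : b ≤ 1 := by nlinarith
    obtain rfl | rfl : b = 0 ∨ b = 1 := by omega
    · refine ⟨1, ?_⟩
      simp [pos, quad]
      linear_combination (1 / 3 : ℂ) * hs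
    · refine ⟨2, ?_⟩
      have h2 : ω ^ (2 : ℤ) = ω ^ 2 := rfl
      simp [pos, quad, h2]
      linear_combination (ω / 3 + 1 / 3 : ℂ) * hs

/-! ### Winding angles -/

/-- The angle of a state. -/
def angle (σ : ℤ × ℕ × ℕ) : ℝ := 2 * Real.pi * σ.1 / 3 + Complex.arg (quad σ.2.1 σ.2.2)

theorem arg_quad_pos (i j : ℕ) : 0 < Complex.arg (quad i j) := by
  have h := quad_im_pos i j
  refine lt_of_le_of_ne (Complex.arg_nonneg_iff.2 h.le) fun h0 => ?_
  exact h.ne' (Complex.arg_eq_zero_iff.1 h0.symm).2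

theorem arg_quad_lt (i j : ℕ) : Complex.arg (quad i j) < Real.pi :=
  Complex.arg_lt_pi_iff.2 (Or.inr (quad_im_pos i j).ne')

theorem pos_polar (m : ℤ) (σ : ℤ × ℕ × ℕ) :
    pos m σ = ‖pos m σ‖ * Complex.exp
      ((angle σ + (Real.pi + 2 * Real.pi * m / 3) : ℝ) * Complex.I) := by
  have hn : ‖pos m σ‖ = ‖quad σ.2.1 σ.2.2‖ := by
    rw [pos, norm_neg, norm_mul, norm_zpow, norm_omega, one_zpow, one_mul]
  have hω : ω ^ (m + σ.1) = Complex.exp ((2 * Real.pi * (m + σ.1) / 3 : ℝ) * Complex.I) := by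
    rw [omega_eq, ← Complex.exp_int_mul]
    congr 1
    push_cast
    ring
  have hq := Complex.norm_mul_exp_arg_mul_I (quad σ.2.1 σ.2.2)
  rw [hn, angle, show ((2 * Real.pi * σ.1 / 3 + Complex.arg (quad σ.2.1 σ.2.2)
      + (Real.pi + 2 * Real.pi * m / 3) : ℝ) : ℂ) * Complex.I
      = (2 * Real.pi * (m + σ.1) / 3 : ℝ) * Complex.I
        + Complex.arg (quad σ.2.1 σ.2.2) * Complex.I + Real.pi * Complex.I by push_cast; ring,
    Complex.exp_add, Complex.exp_add, Complex.exp_pi_mul_I, ← hω, pos]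
  linear_combination (ω ^ (m + σ.1)) * hq

theorem ratio_polar (m : ℤ) (σ τ : ℤ × ℕ × ℕ) :
    pos m τ / pos m σ = ‖pos m τ / pos m σ‖ *
      Complex.exp ((angle τ - angle σ : ℝ) * Complex.I) := by
  have h1 := pos_polar m σ
  have h2 := pos_polar m τ
  have hσ := pos_ne_zero m σ
  have hn : (‖pos m σ‖ : ℂ) ≠ 0 := by exact_mod_cast (norm_pos_iff.2 hσ).ne'
  rw [norm_div, div_eq_iff hσ]
  rw [show ((angle τ + (Real.pi + 2 * Real.pi * m / 3) : ℝ) : ℂ) * Complex.I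
    = (angle τ - angle σ : ℝ) * Complex.I
      + (angle σ + (Real.pi + 2 * Real.pi * m / 3) : ℝ) * Complex.I by push_cast; ring,
    Complex.exp_add] at h2
  generalize ‖pos m σ‖ = a at *
  generalize ‖pos m τ‖ = b at *
  rw [h2, h1]
  push_cast
  field_simp

theorem ratio_im (m : ℤ) (σ τ : ℤ × ℕ × ℕ) :
    (pos m τ / pos m σ).im = ‖pos m τ / pos m σ‖ * Real.sin (angle τ - angle σ) := by
  conv_lhs => rw [ratio_polar m σ τ]
  rw [Complex.im_ofReal_mul, Complex.exp_ofReal_mul_I_im]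

theorem ratio_norm_pos (m : ℤ) (σ τ : ℤ × ℕ × ℕ) : 0 < ‖pos m τ / pos m σ‖ :=
  norm_pos_iff.2 (div_ne_zero (pos_ne_zero _ _) (pos_ne_zero _ _))

theorem ratio_move (σ : ℤ × ℕ × ℕ) (a : Fin 3) :
    pos 0 (move σ a) / pos 0 σ = 1 - ω ^ (a : ℕ) / quad σ.2.1 σ.2.2 := by
  have h := pos_move 0 σ a
  have h1 := quad_ne_zero σ.2.1 σ.2.2
  have h2 : ω ^ (0 + σ.1) ≠ 0 := zpow_ne_zero _ omega_ne_zero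
  rw [sub_eq_iff_eq_add.1 h, add_div, div_self (pos_ne_zero 0 σ), pos]
  field_simp
  ring

/-- Within a sector, `quad` has argument in (0, π), so two arguments differ by less than π. When a
step changes sector the shift ±2π/3 breaks this bound on one side. The sign of the sine, read from
the imaginary part of the ratio of positions, restores it. -/
theorem angle_move_mem (σ : ℤ × ℕ × ℕ) (a : Fin 3) :
    -Real.pi < angle (move σ a) - angle σ ∧ angle (move σ a) - angle σ < Real.pi := by
  have hpi := Real.pi_pos
  have him := ratio_im 0 σ (move σ a)
  have hnorm := ratio_norm_pos 0 σ (move σ a)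
  rw [ratio_move] at him hnorm
  have same : ∀ (k : ℤ) (i j i' j' : ℕ), -Real.pi < angle (k, i, j) - angle (k, i', j') ∧
      angle (k, i, j) - angle (k, i', j') < Real.pi := by
    intro k i j i' j'
    have h1 := arg_quad_pos i j
    have h2 := arg_quad_pos i' j'
    have h3 := arg_quad_lt i j
    have h4 := arg_quad_lt i' j'
    simp only [angle]
    constructor <;> linarith
  obtain ⟨k, i, j⟩ := σ
  obtain rfl | rfl | rfl : a = 0 ∨ a = 1 ∨ a = 2 := by omega
  · rcases i with _ | i
    · have hsin : 0 < Real.sin (angle (move (k, 0, j) 0) - angle (k, 0, j)) := by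
        refine pos_of_mul_pos_right ?_ hnorm.le
        refine lt_of_lt_of_eq ?_ him
        have := quad_im_pos 0 j
        have h0 := quad_ne_zero 0 j
        simp only [Fin.val_zero, pow_zero, Complex.sub_im, Complex.one_im, zero_sub,
          one_div, Complex.inv_im, neg_div, neg_neg]
        exact div_pos this (Complex.normSq_pos.2 h0)
      have h1 := arg_quad_pos 0 j
      have h2 := arg_quad_pos j 0
      have h3 := arg_quad_lt 0 j
      have h4 := arg_quad_lt j 0
      have hD : angle (move (k, 0, j) 0) - angle (k, 0, j)
          = 2 * Real.pi / 3 + Complex.arg (quad j 0) - Complex.arg (quad 0 j) := by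
        simp only [angle, move]
        push_cast
        ring
      refine ⟨by rw [hD]; linarith, ?_⟩
      by_contra! hge
      have := Real.sin_nonneg_of_nonneg_of_le_pi
        (x := angle (move (k, 0, j) 0) - angle (k, 0, j) - Real.pi)
        (by linarith) (by rw [hD]; linarith)
      rw [Real.sin_sub_pi] at this
      linarith
    · have e : move (k, i + 1, j) 0 = (k, i, j) := by simp [move]
      rw [e]
      exact same _ _ _ _ _
  · rcases j with _ | j
    · have hsin : Real.sin (angle (move (k, i, 0) 1) - angle (k, i, 0)) < 0 := by
        refine neg_of_mul_neg_right ?_ hnorm.le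
        refine lt_of_eq_of_lt him.symm ?_
        have h0 := quad_ne_zero i 0
        have hre : (quad i 0).re = 2 / 3 + i + (1 / 3) * ω.re := by
          simp only [quad, Complex.add_re, Complex.ofReal_re, Complex.re_ofReal_mul]
          push_cast
          ring
        have himq : (quad i 0).im = (1 / 3) * ω.im := by
          simp only [quad, Complex.add_im, Complex.ofReal_im, Complex.im_ofReal_mul]
          push_cast
          ring
        have hN := Complex.normSq_pos.2 h0
        have hω := omega_im_pos
        simp only [Fin.val_one, pow_one, Complex.sub_im, Complex.one_im, zero_sub]
        rw [neg_lt_zero, Complex.div_im, ← sub_div, hre, himq]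
        refine div_pos ?_ hN
        have : ω.im * (2 / 3 + i + 1 / 3 * ω.re) - ω.re * (1 / 3 * ω.im)
          = ω.im * (2 / 3 + i) := by ring
        rw [this]
        positivity
      have h1 := arg_quad_pos i 0
      have h2 := arg_quad_pos 0 (i + 1)
      have h3 := arg_quad_lt i 0
      have h4 := arg_quad_lt 0 (i + 1)
      have hD : angle (move (k, i, 0) 1) - angle (k, i, 0)
          = -(2 * Real.pi / 3) + Complex.arg (quad 0 (i + 1)) - Complex.arg (quad i 0) := by
        simp only [angle, move]
        push_cast
        ring
      refine ⟨?_, by rw [hD]; linarith⟩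
      by_contra! hge
      have := Real.sin_nonneg_of_nonneg_of_le_pi
        (x := angle (move (k, i, 0) 1) - angle (k, i, 0) + 2 * Real.pi)
        (by rw [hD]; linarith) (by linarith)
      rw [Real.sin_add_two_pi] at this
      linarith
    · have e : move (k, i, j + 1) 1 = (k, i, j) := by simp [move]
      rw [e]
      exact same _ _ _ _ _
  · have e : move (k, i, j) 2 = (k, i + 1, j + 1) := by simp [move]
    rw [e]
    exact same _ _ _ _ _

theorem arg_ratio_move (m : ℤ) (σ : ℤ × ℕ × ℕ) (a : Fin 3) :
    Complex.arg (pos m (move σ a) / pos m σ) = angle (move σ a) - angle σ := by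
  obtain ⟨h1, h2⟩ := angle_move_mem σ a
  have := Complex.arg_mul_cos_add_sin_mul_I (ratio_norm_pos m σ (move σ a))
    (Set.mem_Ioc.2 ⟨h1, h2.le⟩)
  rwa [← Complex.exp_mul_I, ← ratio_polar] at this

/-- The slit plane is star-shaped about 1, so along the whole step the ratio to the initial position
avoids the cut and `arg` is continuous. In particular no step meets the origin. -/
theorem ratio_move_mem_slitPlane (m : ℤ) (σ : ℤ × ℕ × ℕ) (a : Fin 3) :
    pos m (move σ a) / pos m σ ∈ Complex.slitPlane := by
  rw [Complex.mem_slitPlane_iff_arg, arg_ratio_move]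
  exact ⟨(angle_move_mem σ a).2.ne, div_ne_zero (pos_ne_zero _ _) (pos_ne_zero _ _)⟩

theorem segment_mem_slitPlane {c : ℂ} (hc : c ∈ Complex.slitPlane) {x : ℝ} (h0 : 0 ≤ x)
    (h1 : x ≤ 1) : (1 + x * (c - 1) : ℂ) ∈ Complex.slitPlane := by
  have := Complex.starConvex_one_slitPlane hc (sub_nonneg.2 h1) h0 (sub_add_cancel 1 x)
  convert this using 1
  simp only [Complex.real_smul]
  push_cast
  ring

/-! ### Walks and words -/

/-- The walk given by a word. -/
def path (m : ℤ) : (n : ℕ) → (Fin n → Fin 3) → Fin (n + 1) → ℂ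
  | 0, _ => fun _ => pos m (0, 0, 0)
  | n + 1, w => Fin.snoc (α := fun _ => ℂ) (path m n (Fin.init w)) (pos m (endState (n + 1) w))

theorem path_last (m : ℤ) (n : ℕ) (w : Fin n → Fin 3) :
    path m n w (Fin.last n) = pos m (endState n w) := by
  cases n with
  | zero => rfl
  | succ n => rw [path, Fin.snoc_last]

theorem path_zero (m : ℤ) (n : ℕ) (w : Fin n → Fin 3) : path m n w 0 = pos m (0, 0, 0) := by
  induction n with
  | zero => rfl
  | succ n ih => rw [path, ← Fin.castSucc_zero, Fin.snoc_castSucc, ih]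

theorem path_step (m : ℤ) (n : ℕ) (w : Fin n → Fin 3) (i : Fin n) :
    ∃ σ a, path m n w i.castSucc = pos m σ ∧ path m n w i.succ = pos m (move σ a) := by
  induction n with
  | zero => exact i.elim0
  | succ n ih =>
    refine Fin.lastCases ?_ (fun i => ?_) i
    · refine ⟨endState n (Fin.init w), w (Fin.last n), ?_, ?_⟩
      · rw [path, Fin.snoc_castSucc, path_last]
      · rw [Fin.succ_last, path_last, endState]
    · obtain ⟨σ, a, h1, h2⟩ := ih (Fin.init w) i
      refine ⟨σ, a, ?_, ?_⟩
      · rw [path, Fin.snoc_castSucc, h1]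
      · rw [path, Fin.succ_castSucc, Fin.snoc_castSucc, h2]

theorem isWalk_path (m : ℤ) (n : ℕ) (w : Fin n → Fin 3) : IsWalk (path m n w) := by
  have hedge : ∀ i : Fin n, IsEdge (path m n w i.castSucc) (path m n w i.succ) := by
    intro i
    obtain ⟨σ, a, h1, h2⟩ := path_step m n w i
    rw [h1, h2]
    exact isEdge_move m σ a
  refine ⟨fun i => ?_, hedge⟩
  refine Fin.cases ?_ (fun i => (hedge i).2.1) i
  rw [path_zero]
  exact pos_mem _ _

theorem path_injective (m : ℤ) (n : ℕ) : Function.Injective (path m n) := by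
  induction n with
  | zero => exact fun _ _ _ => Subsingleton.elim _ _
  | succ n ih =>
    intro v w h
    rw [path, path] at h
    have h1 := congrArg Fin.init h
    rw [Fin.init_snoc, Fin.init_snoc] at h1
    have h2 := congrFun h (Fin.last (n + 1))
    rw [Fin.snoc_last, Fin.snoc_last, endState, endState, ih h1] at h2
    rw [← Fin.snoc_init_self v, ← Fin.snoc_init_self w, ih h1, move_injective h2]

theorem exists_path {m : ℤ} {n : ℕ} {p : Fin (n + 1) → ℂ} (hp : IsWalk p)
    (h0 : p 0 = pos m (0, 0, 0)) : ∃ w, path m n w = p := by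
  induction n with
  | zero =>
    refine ⟨Fin.elim0, funext fun i => ?_⟩
    rw [Fin.eq_zero i, h0, path_zero]
  | succ n ih =>
    obtain ⟨w, hw⟩ := ih (p := Fin.init p)
      ⟨fun i => hp.1 i.castSucc, fun i => by
        have := hp.2 i.castSucc
        rwa [Fin.succ_castSucc] at this⟩ h0
    have hlast := hp.2 (Fin.last n)
    have hp' : p (Fin.last n).castSucc = pos m (endState n w) := by
      rw [← path_last, hw]
      rfl
    rw [hp'] at hlast
    obtain ⟨a, ha⟩ := exists_move hlast
    refine ⟨Fin.snoc (α := fun _ => Fin 3) w a, ?_⟩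
    rw [path, Fin.init_snoc, hw, endState, Fin.init_snoc, Fin.snoc_last, ha, Fin.succ_last,
      Fin.snoc_init_self]

/-! ### Winding angles of walks -/

/-- A step of a walk, with its argument. -/
theorem segment_polar (m : ℤ) (σ : ℤ × ℕ × ℕ) (a : Fin 3) (x : ℝ) :
    ((1 - x) * pos m σ + x * pos m (move σ a) : ℂ)
      = ‖((1 - x) * pos m σ + x * pos m (move σ a) : ℂ)‖ * Complex.exp
        ((Complex.arg (1 + x * (pos m (move σ a) / pos m σ - 1))
          + (angle σ + (Real.pi + 2 * Real.pi * m / 3)) : ℝ) * Complex.I) := by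
  have hσ := pos_ne_zero m σ
  have e : ((1 - x) * pos m σ + x * pos m (move σ a) : ℂ)
      = (1 + x * (pos m (move σ a) / pos m σ - 1)) * pos m σ := by
    field_simp
    ring
  rw [e, norm_mul]
  have h1 := pos_polar m σ
  have h2 := Complex.norm_mul_exp_arg_mul_I (1 + x * (pos m (move σ a) / pos m σ - 1))
  generalize (1 + x * (pos m (move σ a) / pos m σ - 1) : ℂ) = z at *
  rw [Complex.ofReal_mul, Complex.ofReal_add, add_mul, Complex.exp_add]
  linear_combination (-pos m σ) * h2 + ‖z‖ * Complex.exp (Complex.arg z * Complex.I) * h1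

theorem segment_ne_zero (m : ℤ) (σ : ℤ × ℕ × ℕ) (a : Fin 3) {x : ℝ} (hx : x ∈ Set.Icc (0 : ℝ) 1) :
    ((1 - x) * pos m σ + x * pos m (move σ a) : ℂ) ≠ 0 := by
  have hσ := pos_ne_zero m σ
  have e : ((1 - x) * pos m σ + x * pos m (move σ a) : ℂ)
      = (1 + x * (pos m (move σ a) / pos m σ - 1)) * pos m σ := by
    field_simp
    ring
  rw [e]
  exact mul_ne_zero (Complex.slitPlane_ne_zero
    (segment_mem_slitPlane (ratio_move_mem_slitPlane m σ a) hx.1 hx.2)) hσ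

theorem exists_determination (m : ℤ) (n : ℕ) (w : Fin n → Fin 3) :
    ∃ φ : ℝ → ℝ, Continuous φ ∧
      (∀ i : Fin n, ∀ x ∈ Set.Icc (0 : ℝ) 1,
        (1 - x) * path m n w i.castSucc + x * path m n w i.succ =
          ‖(1 - x) * path m n w i.castSucc + x * path m n w i.succ‖
            * Complex.exp (φ ((i : ℕ) + x) * Complex.I)) ∧
      φ 0 = angle (0, 0, 0) + (Real.pi + 2 * Real.pi * m / 3) ∧
      φ n = angle (endState n w) + (Real.pi + 2 * Real.pi * m / 3) := by
  induction n with
  | zero =>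
    refine ⟨fun _ => angle (0, 0, 0) + (Real.pi + 2 * Real.pi * m / 3), continuous_const,
      fun i => i.elim0, rfl, rfl⟩
  | succ n ih =>
    obtain ⟨φ, hφ, hp, h0, hn⟩ := ih (Fin.init w)
    have hend : endState (n + 1) w = move (endState n (Fin.init w)) (w (Fin.last n)) := rfl
    generalize hσ : endState n (Fin.init w) = σ at *
    generalize ha : w (Fin.last n) = a at *
    -- The clamps freeze the old determination after time n and let the new argument vary only
    -- between n and n + 1.
    refine ⟨fun x => φ (min x n) + Complex.arg (1 + (min (max (x - n) 0) 1 : ℝ) *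
      (pos m (move σ a) / pos m σ - 1)), ?_, ?_, ?_, ?_⟩
    · refine (hφ.comp (continuous_id.min continuous_const)).add
        (continuous_iff_continuousAt.2 fun x => ?_)
      have hc : Continuous fun x : ℝ => (1 + (min (max (x - n) 0) 1 : ℝ) *
        (pos m (move σ a) / pos m σ - 1) : ℂ) := by fun_prop
      exact ContinuousAt.comp (g := Complex.arg) (Complex.continuousAt_arg
        (segment_mem_slitPlane (ratio_move_mem_slitPlane m σ a)
          (le_min (le_max_right _ _) zero_le_one) (min_le_right _ _))) hc.continuousAt
    · refine fun i => Fin.lastCases (fun x hx => ?_) (fun i x hx => ?_) i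
      · have h1 : path m (n + 1) w (Fin.last n).castSucc = pos m σ := by
          rw [path, Fin.snoc_castSucc, path_last, hσ]
        have h2 : path m (n + 1) w (Fin.last n).succ = pos m (move σ a) := by
          rw [Fin.succ_last, path_last, hend]
        rw [h1, h2]
        have h3 : min ((n : ℝ) + x) n = n := min_eq_right (by linarith [hx.1])
        have h4 : min (max ((n : ℝ) + x - n) 0) 1 = x := by
          rw [add_sub_cancel_left, max_eq_left hx.1, min_eq_left hx.2]
        simp only [Fin.val_last, h3, h4, hn]
        conv_lhs => rw [segment_polar]
        rw [add_comm (Complex.arg _)]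
      · have h1 : path m (n + 1) w i.castSucc.castSucc = path m n (Fin.init w) i.castSucc := by
          rw [path, Fin.snoc_castSucc]
        have h2 : path m (n + 1) w i.castSucc.succ = path m n (Fin.init w) i.succ := by
          rw [path, Fin.succ_castSucc, Fin.snoc_castSucc]
        rw [h1, h2]
        have hi : ((i : ℕ) : ℝ) + 1 ≤ n := by exact_mod_cast i.2
        have h3 : min (((i : ℕ) : ℝ) + x) n = i + x := min_eq_left (by linarith [hx.2])
        have h4 : min (max (((i : ℕ) : ℝ) + x - n) 0) 1 = 0 := by
          rw [max_eq_right (by linarith [hx.2]), min_eq_left zero_le_one]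
        simp only [Fin.val_castSucc, h3, h4, Complex.ofReal_zero, zero_mul, add_zero,
          Complex.arg_one]
        exact hp i x hx
    · have h3 : min (0 : ℝ) n = 0 := min_eq_left n.cast_nonneg
      have h4 : min (max ((0 : ℝ) - n) 0) 1 = 0 := by
        rw [max_eq_right (by simp), min_eq_left zero_le_one]
      simp only [h3, h4, Complex.ofReal_zero, zero_mul, add_zero, Complex.arg_one, h0]
    · have h3 : min ((n + 1 : ℕ) : ℝ) n = n := min_eq_right (by push_cast; linarith)
      have h4 : min (max (((n + 1 : ℕ) : ℝ) - n) 0) 1 = 1 := by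
        push_cast
        rw [add_sub_cancel_left, max_eq_left zero_le_one, min_self]
      simp only [h3, h4, Complex.ofReal_one, one_mul, add_sub_cancel, hn, arg_ratio_move, hend]
      ring

theorem hasWindingAngle_path (m : ℤ) (n : ℕ) (w : Fin n → Fin 3) :
    HasWindingAngle (path m n w) (angle (endState n w) - angle (0, 0, 0)) := by
  obtain ⟨φ, hφ, hp, h0, hn⟩ := exists_determination m n w
  exact ⟨φ, hφ.continuousOn, hp, by rw [h0, hn]; ring⟩

/-- Two determinations differ by a continuous function with values in the discrete group 2πℤ, which
is constant on an interval. -/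
theorem hasWindingAngle_unique {n : ℕ} {p : Fin (n + 1) → ℂ}
    (hp : ∀ i : Fin n, ∀ x ∈ Set.Icc (0 : ℝ) 1,
      ((1 - x) * p i.castSucc + x * p i.succ : ℂ) ≠ 0) {θ θ' : ℝ}
    (h : HasWindingAngle p θ) (h' : HasWindingAngle p θ') : θ = θ' := by
  obtain ⟨φ, hφ, hφp, rfl⟩ := h
  obtain ⟨ψ, hψ, hψp, rfl⟩ := h'
  -- A walk of length 0 puts no condition on φ, but its time interval is a point and the increase is
  -- 0.
  rcases n with _ | n
  · simp
  have hmaps : Set.MapsTo (fun y => φ y - ψ y) (Set.Icc 0 ((n + 1 : ℕ) : ℝ))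
      (AddSubgroup.zmultiples (2 * Real.pi) : Set ℝ) := by
    intro y hy
    obtain ⟨i, x, hx, rfl⟩ : ∃ i : Fin (n + 1), ∃ x ∈ Set.Icc (0 : ℝ) 1, y = (i : ℕ) + x := by
      have h0 := Nat.floor_le hy.1
      rcases lt_or_ge ⌊y⌋₊ (n + 1) with hlt | hge
      · exact ⟨⟨_, hlt⟩, y - ⌊y⌋₊, ⟨by linarith, by linarith [Nat.lt_floor_add_one y]⟩, by simp⟩
      · refine ⟨Fin.last n, 1, ⟨zero_le_one, le_rfl⟩, ?_⟩
        have : ((n + 1 : ℕ) : ℝ) ≤ ⌊y⌋₊ := by exact_mod_cast hge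
        have := hy.2
        push_cast at *
        linarith
    have h1 := hφp i x hx
    have h2 := hψp i x hx
    have hne := hp i x hx
    generalize ((1 - x) * p i.castSucc + x * p i.succ : ℂ) = z at *
    have hz : (‖z‖ : ℂ) ≠ 0 := by exact_mod_cast (norm_pos_iff.2 hne).ne'
    obtain ⟨k, hk⟩ := Complex.exp_eq_exp_iff_exists_int.1 (mul_left_cancel₀ hz (h1.symm.trans h2))
    refine AddSubgroup.mem_zmultiples_iff.2 ⟨k, ?_⟩
    have hk' : ((φ ((i : ℕ) + x) : ℝ) : ℂ) = ((ψ ((i : ℕ) + x) + k * (2 * Real.pi) : ℝ) : ℂ) := by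
      refine mul_right_cancel₀ Complex.I_ne_zero ?_
      rw [hk]
      push_cast
      ring
    have := Complex.ofReal_injective hk'
    simp only [zsmul_eq_mul, this]
    ring
  have hconst := isPreconnected_Icc.constant_of_mapsTo
    (isDiscrete_iff_discreteTopology.2 (inferInstanceAs (DiscreteTopology
      (AddSubgroup.zmultiples (2 * Real.pi))))) (hφ.sub hψ) hmaps
    (Set.left_mem_Icc.2 (Nat.cast_nonneg _)) (Set.right_mem_Icc.2 (Nat.cast_nonneg _))
  simp only [Pi.sub_apply] at hconst
  linarith

theorem path_segment_ne_zero (m : ℤ) (n : ℕ) (w : Fin n → Fin 3) (i : Fin n) (x : ℝ)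
    (hx : x ∈ Set.Icc (0 : ℝ) 1) :
    ((1 - x) * path m n w i.castSucc + x * path m n w i.succ : ℂ) ≠ 0 := by
  obtain ⟨σ, a, h1, h2⟩ := path_step m n w i
  rw [h1, h2]
  exact segment_ne_zero m σ a hx

theorem hasWindingAngle_path_iff (m : ℤ) (n : ℕ) (w : Fin n → Fin 3) (θ : ℝ) :
    HasWindingAngle (path m n w) θ ↔ θ = angle (endState n w) - angle (0, 0, 0) :=
  ⟨fun h => hasWindingAngle_unique (path_segment_ne_zero m n w) h (hasWindingAngle_path m n w),
    fun h => h ▸ hasWindingAngle_path m n w⟩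

theorem angle_sub (k : ℤ) : angle (k, 0, 0) - angle (0, 0, 0) = 2 * Real.pi * k / 3 := by
  simp [angle]

theorem isExcursion_iff (m : ℤ) (n : ℕ) (p : Fin (n + 1) → ℂ) :
    IsExcursion (pos m (0, 0, 0)) p ↔ ∃ w, path m n w = p ∧ (endState n w).2 = (0, 0) := by
  constructor
  · rintro ⟨hp, h0, hc⟩
    obtain ⟨w, rfl⟩ := exists_path hp h0
    rw [path_last, isClosest_pos_iff] at hc
    exact ⟨w, rfl, hc⟩
  · rintro ⟨w, rfl, h⟩
    exact ⟨isWalk_path m n w, path_zero m n w, by rwa [path_last, isClosest_pos_iff]⟩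

theorem exists_windingAngle {w₀ : ℂ} (hw₀ : IsClosest w₀) {n : ℕ} {p : Fin (n + 1) → ℂ}
    (hp : IsExcursion w₀ p) : (∃! θ : ℝ, HasWindingAngle p θ) ∧
      ∃ k : ℤ, HasWindingAngle p (2 * Real.pi * k / 3) := by
  obtain ⟨m, rfl⟩ := exists_pos_of_isClosest hw₀
  obtain ⟨w, rfl, hw⟩ := (isExcursion_iff m n p).1 hp
  simp only [hasWindingAngle_path_iff]
  refine ⟨⟨_, rfl, fun _ h => h⟩, (endState n w).1, ?_⟩
  rw [← angle_sub, ← hw]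

/-- Words correspond bijectively to walks from the chosen corner, and for an excursion the winding
angle recovers the sector number of the final state. The count is therefore the same for all three
corners. -/
theorem excursionCount_eq (m : ℤ) (n : ℕ) (k : ℤ) : excursionCount (pos m (0, 0, 0)) n k
    = (Finset.univ.filter fun w : Fin n → Fin 3 => endState n w = (k, 0, 0)).card := by
  have hiff : ∀ w, (endState n w = (k, 0, 0)) ↔ ((endState n w).2 = (0, 0) ∧
      HasWindingAngle (path m n w) (2 * Real.pi * k / 3)) := by
    intro w
    rw [hasWindingAngle_path_iff, ← angle_sub]
    constructor
    · intro h
      rw [h]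
      exact ⟨rfl, rfl⟩
    · rintro ⟨h1, h2⟩
      have e : endState n w = ((endState n w).1, 0, 0) := by rw [← h1]
      rw [e, angle_sub, angle_sub] at h2
      have hpi := Real.pi_ne_zero
      field_simp at h2
      rw [e, ← (by exact_mod_cast h2 : k = (endState n w).1)]
  rw [excursionCount, ← Fintype.card_subtype, ← Nat.card_eq_fintype_card]
  refine Nat.card_congr (Equiv.ofBijective (fun w => ⟨path m n w.1,
    (isExcursion_iff m n _).2 ⟨w.1, rfl, ((hiff w.1).1 w.2).1⟩, ((hiff w.1).1 w.2).2⟩)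
    ⟨fun v w h => ?_, ?_⟩).symm
  · exact Subtype.ext (path_injective m n (congrArg Subtype.val h))
  · rintro ⟨p, hp, hk⟩
    obtain ⟨w, rfl, hw⟩ := (isExcursion_iff m n p).1 hp
    exact ⟨⟨w, (hiff w).2 ⟨hw, hk⟩⟩, rfl⟩

theorem finsum_excursionCount (m : ℤ) (n : ℕ) :
    ∑ᶠ k : ℤ, (excursionCount (pos m (0, 0, 0)) n k : RatFunc ℚ) * RatFunc.X ^ k
      = ∑ w : Fin n → Fin 3,
        if (endState n w).2 = (0, 0) then RatFunc.X ^ (endState n w).1 else 0 := by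
  have h : ∀ k : ℤ, (excursionCount (pos m (0, 0, 0)) n k : RatFunc ℚ) * RatFunc.X ^ k
      = ∑ w : Fin n → Fin 3, if endState n w = (k, 0, 0) then RatFunc.X ^ k else 0 := by
    intro k
    rw [excursionCount_eq, ← Finset.sum_filter, Finset.sum_const, nsmul_eq_mul]
  have hs : ∀ (w : Fin n → Fin 3) (k : ℤ), k ≠ (endState n w).1 →
      (if endState n w = (k, 0, 0) then RatFunc.X ^ k else 0 : RatFunc ℚ) = 0 := by
    intro w k hk
    exact if_neg fun h => hk (by rw [h])
  simp only [h]
  rw [finsum_sum_comm]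
  · refine Finset.sum_congr rfl fun w _ => ?_
    rw [finsum_eq_single _ _ (hs w)]
    simp [Prod.ext_iff]
  · intro w _
    refine (Set.finite_singleton (endState n w).1).subset fun k hk => ?_
    by_contra hne
    exact hk (hs w k hne)

theorem formalSum_X_pow_mul_C {A : Type*} [CommRing A] (c : ℕ → A) :
    formalSum (fun n => PowerSeries.X ^ n * PowerSeries.C (c n)) = PowerSeries.mk c := by
  ext m
  rw [formalSum, PowerSeries.coeff_mk, PowerSeries.coeff_mk]
  simp [PowerSeries.coeff_mul_C, PowerSeries.coeff_X_pow]

theorem genE_eq {w₀ : ℂ} (hw₀ : IsClosest w₀) : genE w₀ = toL (originSeries RatFunc.X) := by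
  obtain ⟨m, rfl⟩ := exists_pos_of_isClosest hw₀
  simp only [genE, finsum_excursionCount]
  rw [originSeries, ← formalSum_X_pow_mul_C]
  simp only [map_sum, apply_ite PowerSeries.C, map_zero]

end

end WindingSeries

theorem theorem1 :
    -- the implicit equation has exactly one solution `q(t)`
    (∃! q : PowerSeries ℚ, ∃ r : PowerSeries ℚ, KrewerasWinding.IsNome q r) ∧
    -- the winding angle of each walk in question is well defined and a multiple of `2π/3`
    (∀ w₀ : ℂ, KrewerasWinding.IsClosest w₀ → ∀ (n : ℕ) (p : Fin (n + 1) → ℂ),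
      KrewerasWinding.IsExcursion w₀ p →
        (∃! θ : ℝ, KrewerasWinding.HasWindingAngle p θ) ∧
        ∃ k : ℤ, KrewerasWinding.HasWindingAngle p (2 * Real.pi * k / 3)) ∧
    ∀ q r : PowerSeries ℚ, KrewerasWinding.IsNome q r →
      -- `q = t^3 + 15 t^6 + 279 t^9 + O(t^12)`
      (PowerSeries.X ^ 12 ∣ q - (PowerSeries.X ^ 3 + 15 * PowerSeries.X ^ 6
        + 279 * PowerSeries.X ^ 9)) ∧
      -- the expression for `E(t,s)` is meaningful: its series converge, its denominators are not zero
      (∀ k : ℕ,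
        Summable (KrewerasWinding.termT k 1 (KrewerasWinding.incl q ^ 3)) ∧
        Summable (KrewerasWinding.termT k (KrewerasWinding.incl q)
          (KrewerasWinding.incl q ^ 3)) ∧
        Summable (KrewerasWinding.termT k (KrewerasWinding.incl q ^ 2)
          (KrewerasWinding.incl q ^ 3)) ∧
        Summable (KrewerasWinding.termT k
          (KrewerasWinding.s * KrewerasWinding.incl r ^ (-2 : ℤ)) (KrewerasWinding.incl q))) ∧
      KrewerasWinding.T 1 1 (KrewerasWinding.incl q ^ 3) ≠ 0 ∧
      KrewerasWinding.T 0 (KrewerasWinding.s * KrewerasWinding.incl r ^ (-2 : ℤ))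
        (KrewerasWinding.incl q) ≠ 0 ∧
      -- the formula for `E(t,s)`, for each starting vertex closest to the origin
      ∀ w₀ : ℂ, KrewerasWinding.IsClosest w₀ →
        KrewerasWinding.genE w₀ =
          KrewerasWinding.s / ((1 - KrewerasWinding.s ^ 3) * KrewerasWinding.t) *
            (KrewerasWinding.s
              - (KrewerasWinding.incl r)⁻¹ *
                (KrewerasWinding.T 1 (KrewerasWinding.incl q ^ 2) (KrewerasWinding.incl q ^ 3) /
                  KrewerasWinding.T 1 1 (KrewerasWinding.incl q ^ 3))
              - (KrewerasWinding.incl r)⁻¹ *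
                ((KrewerasWinding.T 0 (KrewerasWinding.incl q) (KrewerasWinding.incl q ^ 3) *
                    KrewerasWinding.T 1
                      (KrewerasWinding.s * KrewerasWinding.incl r ^ (-2 : ℤ))
                      (KrewerasWinding.incl q)) /
                  (KrewerasWinding.T 1 1 (KrewerasWinding.incl q ^ 3) *
                    KrewerasWinding.T 0
                      (KrewerasWinding.s * KrewerasWinding.incl r ^ (-2 : ℤ))
                      (KrewerasWinding.incl q)))) := by
  refine ⟨WindingSeries.existsUnique_nome,
    fun w₀ hw₀ n p hp => WindingSeries.exists_windingAngle hw₀ hp, fun q r h => ?_⟩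
  have hr := WindingSeries.X_dvd_extend (WindingSeries.X_dvd_of_isNome h)
  have hr0 := WindingSeries.extend_ne_zero_of_isNome h
  rw [WindingSeries.incl_pow_of_isNome h, WindingSeries.incl_eq_toL]
  refine ⟨WindingSeries.expansion_of_isNome h, fun k => ⟨?_, ?_, ?_, ?_⟩,
    WindingSeries.T_one_one_ne_zero hr hr0, WindingSeries.T_aux_zero_ne_zero hr hr0,
    fun w₀ hw₀ => ?_⟩
  · have := ((WindingSeries.represents_theta hr hr0 (Nat.zero_le 2)).hasSum k).summable
    rwa [pow_zero] at this
  · have := ((WindingSeries.represents_theta hr hr0 one_le_two).hasSum k).summable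
    rwa [pow_one] at this
  · exact ((WindingSeries.represents_theta hr hr0 le_rfl).hasSum k).summable
  · exact ((WindingSeries.represents_aux hr hr0).hasSum k).summable
  · rw [WindingSeries.genE_eq hw₀]
    exact WindingSeries.originSeries_eq hr hr0 (WindingSeries.relation_of_isNome h)
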